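/- **Global relation for the Chen–Lee–Liu (CLL-NLS) equation on the half-line.** Let $0<T<\infty$ and let $r$ be a complex-valued function on $\{z\ge 0,\ 0\le t\le T\}$ of Schwartz class (smooth up to the boundary, all partial derivatives decaying faster than any power of $z$, uniformly in $t$) which satisfies $$ i r_t+r_{zz}+|r|^2r-i|r|^2r_z=0,\qquad z>0,\ 0<t<T. $$ For $\varsigma\in\mathbb C$ put $\lambda=\varsigma^2-\tfrac12$, $\sigma=\mathrm{diag}(1,-1)$, $e^{x\hat\sigma}M=e^{x\sigma}Me^{-x\sigma}$, $R=\begin{pmatrix}0&r\\-\bar r&0\end{pmatrix}$, $$A=\varsigma R+\tfrac14 iR^2\sigma,\qquad B=-2\varsigma^3R-i\varsigma^2R^2\sigma+\varsigma\bigl(R+i\sigma R_z-\tfrac12R^3\bigr)-\tfrac18iR^4\sigma+\tfrac14(RR_z-R_zR),$$ so that $\Psi_z-i\lambda\sigma\Psi=A\Psi$, $\Psi_t+2i\lambda^2\sigma\Psi=B\Psi$ is the Lax pair. Let $\Theta=\Theta_1dz+\Theta_2dt$ with $\Theta_1=\tfrac14|r|^2$, $\Theta_2=\tfrac18|r|^4+\tfrac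 i4(\bar r r_z-r\bar r_z)$ (a closed 1-form), let $\theta(z,t)=\int_{(0,0)}^{(z,t)}\Theta$, and put $$A_1=e^{-i\theta\hat\sigma}(A-i\Theta_1\sigma),\qquad B_1=e^{-i\theta\hat\sigma}(B-i\Theta_2\sigma).$$ 1. For every $\varsigma\in\mathbb C$ there is a unique continuous matrix function $H_1(0,\cdot,\varsigma)$ on $[0,T]$ with $$H_1(0,t,\varsigma)=I+\int_0^te^{-2i\lambda^2(t-\tau)\hat\sigma}(B_1H_1)(0,\tau,\varsigma)\,d\tau ,$$ and $W(\varsigma)^{-1}:=e^{2i\lambda^2T\hat\sigma}H_1(0,T,\varsigma)$ is invertible; let $(V(\varsigma),U(\varsigma))^{\mathsf T}$ be the second column of $W(\varsigma)$. 2. For every $\varsigma$ with $\operatorname{Im}\varsigma^2\le0$ and every $t\in[0,T]$ there is a unique bounded continuous function $[H_3]_2(\cdot,t,\varsigma)$ on $[0,\infty)$ that solves the second column of $$H_3(z,t,\varsigma)=I-\int_z^\infty e^{i\lambda(z-\zeta)\hat\sigma}(A_1H_3)(\zeta,t,\varsigma)\,d\zeta ;$$ let $(v(\varsigma),u(\varsigma))^{\mathsf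 T}=[H_3]_2(0,0,\varsigma)$. 3. (Global relation.) For every $\varsigma$ with $\operatorname{Im}\varsigma^2\le0$, $$u(\varsigma)V(\varsigma)-U(\varsigma)v(\varsigma)=e^{4i(\varsigma^2-\frac12)^2T}\,c^+(\varsigma),\qquad c^+(\varsigma)=\int_0^\infty e^{-2i(\varsigma^2-\frac12)\zeta}(A_1H_3)_{12}(\zeta,T,\varsigma)\,d\zeta ,$$ where the integral converges absolutely. -/

import Mathlib

open Set MeasureTheory Matrix
open scoped ContDiff

namespace CLL

noncomputable section

/-! ## The equation -/

/-- The closed half-strip `0 ≤ z`, `0 ≤ t ≤ T`; a point is a pair `p = (z, t)`. -/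
def strip (T : ℝ) : Set (ℝ × ℝ) := Ici 0 ×ˢ Icc 0 T

/-- `r` is of Schwartz class on the half-strip: smooth up to the boundary, all derivatives decaying
faster than every power of `z`. -/
structure IsSchwartz (T : ℝ) (r : ℝ × ℝ → ℂ) : Prop where
  smooth : ContDiffOn ℝ ∞ r (strip T)
  decay : ∀ k n : ℕ, ∃ C : ℝ, ∀ p ∈ strip T,
    |p.1| ^ k * ‖iteratedFDerivWithin ℝ n r (strip T) p‖ ≤ C

/-- The partial derivative `r_z` (one-sided at `z = 0`). -/
def dz (r : ℝ × ℝ → ℂ) (p : ℝ × ℝ) : ℂ := derivWithin (fun x : ℝ => r (x, p.2)) (Ici 0) p.1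

/-- The partial derivative `r_t`. -/
def dt (r : ℝ × ℝ → ℂ) (p : ℝ × ℝ) : ℂ := deriv (fun s : ℝ => r (p.1, s)) p.2

/-- `i r_t + r_zz + |r|² r - i |r|² r_z = 0` for `0 < z`, `0 < t < T`. -/
def IsSolution (T : ℝ) (r : ℝ × ℝ → ℂ) : Prop :=
  ∀ z t : ℝ, 0 < z → 0 < t → t < T →
    Complex.I * dt r (z, t) + dz (dz r) (z, t) + (‖r (z, t)‖ : ℂ) ^ 2 * r (z, t)
      - Complex.I * (‖r (z, t)‖ : ℂ) ^ 2 * dz r (z, t) = 0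

/-! ## The Lax pair -/

/-- `σ = diag(1, -1)`. -/
def sigma : Matrix (Fin 2) (Fin 2) ℂ := !![1, 0; 0, -1]

/-- `e^{xσ}`. -/
def expSigma (x : ℂ) : Matrix (Fin 2) (Fin 2) ℂ := !![Complex.exp x, 0; 0, Complex.exp (-x)]

/-- `e^{x σ̂} M = e^{xσ} M e^{-xσ}`. -/
def expSigmaHat (x : ℂ) (M : Matrix (Fin 2) (Fin 2) ℂ) : Matrix (Fin 2) (Fin 2) ℂ :=
  expSigma x * M * expSigma (-x)

/-- The action of `e^{x σ̂}` on the second column of a matrix; see `expSigmaHat_col`. -/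
def expSigmaHatCol (x : ℂ) (m : Fin 2 → ℂ) : Fin 2 → ℂ := Complex.exp x • (expSigma x *ᵥ m)

theorem expSigmaHat_col (x : ℂ) (M : Matrix (Fin 2) (Fin 2) ℂ) :
    (expSigmaHat x M).col 1 = expSigmaHatCol x (M.col 1) := by
  rw [Matrix.eta_fin_two M]
  ext i
  fin_cases i
  · simp [expSigmaHat, expSigmaHatCol, expSigma, Matrix.col, vecHead, vecTail]
    ring
  · simp [expSigmaHat, expSigmaHatCol, expSigma, Matrix.col, vecHead, vecTail]
    ring

/-- `λ = ς² - 1/2`. -/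
def lam (s : ℂ) : ℂ := s ^ 2 - 1 / 2

/-- The potential matrix `R`. -/
def R (r : ℝ × ℝ → ℂ) (p : ℝ × ℝ) : Matrix (Fin 2) (Fin 2) ℂ :=
  !![0, r p; -(starRingEnd ℂ) (r p), 0]

/-- Its derivative `R_z`. -/
def Rz (r : ℝ × ℝ → ℂ) (p : ℝ × ℝ) : Matrix (Fin 2) (Fin 2) ℂ :=
  !![0, dz r p; -(starRingEnd ℂ) (dz r p), 0]

/-- The Lax pair is `Ψ_z - iλσΨ = AΨ`, `Ψ_t + 2iλ²σΨ = BΨ`; this is `A`. -/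
def A (r : ℝ × ℝ → ℂ) (p : ℝ × ℝ) (s : ℂ) : Matrix (Fin 2) (Fin 2) ℂ :=
  s • R r p + (Complex.I / 4) • (R r p ^ 2 * sigma)

/-- The matrix `B` of the Lax pair. -/
def B (r : ℝ × ℝ → ℂ) (p : ℝ × ℝ) (s : ℂ) : Matrix (Fin 2) (Fin 2) ℂ :=
  -(2 * s ^ 3) • R r p - (Complex.I * s ^ 2) • (R r p ^ 2 * sigma)
    + s • (R r p + Complex.I • (sigma * Rz r p) - (1 / 2 : ℂ) • R r p ^ 3)
    - (Complex.I / 8) • (R r p ^ 4 * sigma)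
    + (1 / 4 : ℂ) • (R r p * Rz r p - Rz r p * R r p)

/-- The closed 1-form `Θ = Θ₁ dz + Θ₂ dt`: the coefficient `Θ₁ = |r|²/4`. -/
def Theta1 (r : ℝ × ℝ → ℂ) (p : ℝ × ℝ) : ℂ := (‖r p‖ : ℂ) ^ 2 / 4

/-- The coefficient `Θ₂ = |r|⁴/8 + (i/4)(r̄ r_z - r r̄_z)`. -/
def Theta2 (r : ℝ × ℝ → ℂ) (p : ℝ × ℝ) : ℂ :=
  (‖r p‖ : ℂ) ^ 4 / 8
    + Complex.I / 4 * ((starRingEnd ℂ) (r p) * dz r p - r p * (starRingEnd ℂ) (dz r p))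

/-- `∫_{(0,0)}^{(z,t)} Θ`, along `z = 0` from time `0` to time `t` and then along the horizontal
segment to `(z, t)`. -/
def theta (r : ℝ × ℝ → ℂ) (p : ℝ × ℝ) : ℂ :=
  (∫ τ in (0 : ℝ)..p.2, Theta2 r (0, τ)) + ∫ ζ in (0 : ℝ)..p.1, Theta1 r (ζ, p.2)

/-- `A₁ = e^{-i(∫Θ)σ̂}(A - iΘ₁σ)`. -/
def A1 (r : ℝ × ℝ → ℂ) (p : ℝ × ℝ) (s : ℂ) : Matrix (Fin 2) (Fin 2) ℂ :=
  expSigmaHat (-(Complex.I * theta r p)) (A r p s - (Complex.I * Theta1 r p) • sigma)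

/-- `B₁ = e^{-i(∫Θ)σ̂}(B - iΘ₂σ)`. -/
def B1 (r : ℝ × ℝ → ℂ) (p : ℝ × ℝ) (s : ℂ) : Matrix (Fin 2) (Fin 2) ℂ :=
  expSigmaHat (-(Complex.I * theta r p)) (B r p s - (Complex.I * Theta2 r p) • sigma)

/-! ## The eigenfunctions -/

/-- `H` is `t ↦ H₁(0, t, ς)` on `[0, T]`: the continuous solution of
`H(t) = I + ∫₀ᵗ e^{-2iλ²(t-τ)σ̂} (B₁ H)(0, τ, ς) dτ`. -/
structure IsH1 (T : ℝ) (r : ℝ × ℝ → ℂ) (s : ℂ) (H : ℝ → Matrix (Fin 2) (Fin 2) ℂ) : Prop where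
  continuousOn : ContinuousOn H (Icc 0 T)
  eq : ∀ t ∈ Icc (0 : ℝ) T, ∀ i j : Fin 2,
    H t i j = (1 : Matrix (Fin 2) (Fin 2) ℂ) i j
      + ∫ τ in (0 : ℝ)..t,
          expSigmaHat (-(2 * Complex.I * lam s ^ 2 * ((t - τ : ℝ) : ℂ)))
            (B1 r (0, τ) s * H τ) i j

/-- `h` is `z ↦ [H₃]₂(z, t, ς)` on `[0, ∞)`, the second column of `H₃`: the bounded continuous
solution of the second column of
`H₃(z) = I - ∫_z^∞ e^{iλ(z-ζ)σ̂} (A₁ H₃)(ζ, t, ς) dζ`. -/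
structure IsH3 (r : ℝ × ℝ → ℂ) (t : ℝ) (s : ℂ) (h : ℝ → Fin 2 → ℂ) : Prop where
  continuousOn : ContinuousOn h (Ici 0)
  bounded : ∃ C : ℝ, ∀ z ∈ Ici (0 : ℝ), ‖h z‖ ≤ C
  eq : ∀ z ∈ Ici (0 : ℝ), ∀ i : Fin 2,
    h z i = (1 : Matrix (Fin 2) (Fin 2) ℂ) i 1
      - ∫ ζ in Ioi z,
          expSigmaHatCol (Complex.I * lam s * ((z - ζ : ℝ) : ℂ)) (A1 r (ζ, t) s *ᵥ h ζ) i

/-- `H₁(0, ·, ς)`. -/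
def H1 (T : ℝ) (r : ℝ × ℝ → ℂ) (s : ℂ) : ℝ → Matrix (Fin 2) (Fin 2) ℂ :=
  Classical.epsilon (IsH1 T r s)

/-- `[H₃]₂(·, t, ς)`. -/
def H3 (r : ℝ × ℝ → ℂ) (t : ℝ) (s : ℂ) : ℝ → Fin 2 → ℂ :=
  Classical.epsilon (IsH3 r t s)

/-! ## The spectral functions -/

/-- `W(ς)⁻¹ = e^{2iλ²Tσ̂} H₁(0, T, ς)`. -/
def Winv (T : ℝ) (r : ℝ × ℝ → ℂ) (s : ℂ) : Matrix (Fin 2) (Fin 2) ℂ :=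
  expSigmaHat (2 * Complex.I * lam s ^ 2 * (T : ℂ)) (H1 T r s T)

/-- `W(ς)`, whose second column is `(V, U)ᵀ`. -/
def W (T : ℝ) (r : ℝ × ℝ → ℂ) (s : ℂ) : Matrix (Fin 2) (Fin 2) ℂ := (Winv T r s)⁻¹

/-- `V = W₁₂`. -/
def V (T : ℝ) (r : ℝ × ℝ → ℂ) (s : ℂ) : ℂ := W T r s 0 1

/-- `U = W₂₂`. -/
def U (T : ℝ) (r : ℝ × ℝ → ℂ) (s : ℂ) : ℂ := W T r s 1 1

/-- `(v, u)ᵀ` is the second column of `w(ς) = H₃(0, 0, ς)`. -/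
def v (r : ℝ × ℝ → ℂ) (s : ℂ) : ℂ := H3 r 0 s 0 0

/-- See `v`. -/
def u (r : ℝ × ℝ → ℂ) (s : ℂ) : ℂ := H3 r 0 s 0 1

/-- The integrand `e^{-2iλζ} (A₁ H₃)₁₂(ζ, T, ς)` of `c⁺`. -/
def cPlusIntegrand (T : ℝ) (r : ℝ × ℝ → ℂ) (s : ℂ) (ζ : ℝ) : ℂ :=
  Complex.exp (-(2 * Complex.I * lam s * (ζ : ℂ))) * (A1 r (ζ, T) s *ᵥ H3 r T s ζ) 0

/-- `c⁺(ς) = ∫₀^∞ e^{-2iλζ} (A₁ H₃)₁₂(ζ, T, ς) dζ`. -/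
def cPlus (T : ℝ) (r : ℝ × ℝ → ℂ) (s : ℂ) : ℂ := ∫ ζ in Ioi (0 : ℝ), cPlusIntegrand T r s ζ

end

end CLL

namespace CLL

open Filter Topology

/-! ## Volterra equations -/

/-! The relation compares two descriptions of one boundary function. Let `h(z,t)` be the second
column of `H₃`. If `h` solves both halves of the Lax pair, then along `z = 0` it obeys the linear
equation in `t` whose fundamental solution is `H₁`. After the free evolution is removed, `W⁻¹`
carries `h(0,0) = (v,u)ᵀ` to time `T`; the upper component there is `e^{4iλ²T} h₁(0,T)`, and the
integral equation at `z = 0` gives `h₁(0,T) = -c⁺`. The system is trace-free, so `det W⁻¹ = 1` and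
`W` is the adjugate of `W⁻¹`; hence `uV - Uv` is minus the upper component of `W⁻¹(v,u)ᵀ`. This is
`Winv_mulVec` followed by `global_relation`.

The real work is that `h`, constructed for each `t` separately from data at `z = ∞`, evolves in `t`
by the second Lax equation (`IsContractionGroup.evolution`). No `t`-derivative of `h` is assumed.
Put `L(z,t) = h(z,0) + ∫₀ᵗ Y h dτ`, with `Y` the full coefficient of the `t`-equation, and `e = h -
L`. Zero curvature and an integration in `τ` give `e_z = Λe + ae - ∫₀ᵗ a_t e dτ`, an equation in `e`
alone. Since `Y` tends to a constant annihilating the normalisation vector, `e` vanishes at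
infinity, so `e` solves a homogeneous Volterra equation and is zero.

Existence and uniqueness rest on weights. For a kernel of size `C/(1+z)²` the Volterra operator
halves bounds relative to `exp(2C/(1+z))`; on `[0,T]` the weight `exp(2Ct)` does the same. Halving
gives a contracting iterate for existence, and for homogeneous equations it forces the solution to
vanish. The condition `Im ς² ≤ 0` makes the free propagator in `z` a contraction.

Two facts about the potential enter: `Θ` is closed (`theta_eq_add_integral`), which gives the phase
its time derivative, and the gauge-transformed pair has zero curvature (`hasDerivAt_A1`,
`hasDerivAt_B1`). -/

/-- A function dominated by a weight vanishes if every domination improves by a factor two. -/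
theorem eq_zero_of_halving {X E : Type*} [NormedAddCommGroup E] {g : X → E} {φ : X → ℝ}
    {S : Set X} {K₀ : ℝ} (hK₀ : 0 ≤ K₀) (h₀ : ∀ x ∈ S, ‖g x‖ ≤ K₀ * φ x)
    (hstep : ∀ K : ℝ, 0 ≤ K → (∀ x ∈ S, ‖g x‖ ≤ K * φ x) → ∀ x ∈ S, ‖g x‖ ≤ K / 2 * φ x) :
    ∀ x ∈ S, g x = 0 := by
  have hn : ∀ n : ℕ, ∀ x ∈ S, ‖g x‖ ≤ K₀ * (1 / 2) ^ n * φ x := by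
    intro n
    induction n with
    | zero => simpa using h₀
    | succ n ih =>
      intro x hx
      have := hstep _ (by positivity) ih x hx
      rw [pow_succ]
      linarith
  intro x hx
  have hlim : Tendsto (fun n : ℕ => K₀ * (1 / 2 : ℝ) ^ n * φ x) atTop (𝓝 (K₀ * 0 * φ x)) :=
    ((tendsto_pow_atTop_nhds_zero_of_lt_one (by norm_num) (by norm_num)).const_mul _).mul_const _
  have := ge_of_tendsto' hlim fun n => hn n x hx
  simpa using this

/-- A self-map of a space of bounded continuous functions that halves weighted distances has a
fixed point. -/
theorem exists_fixedPoint_of_halving {X E : Type*} [TopologicalSpace X] [NormedAddCommGroup E]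
    [CompleteSpace E] (f : BoundedContinuousFunction X E → BoundedContinuousFunction X E)
    {φ : X → ℝ} {M : ℝ} (hφ : ∀ x, 1 ≤ φ x) (hM : ∀ x, φ x ≤ M)
    (hf : ∀ (g h : BoundedContinuousFunction X E) (K : ℝ), 0 ≤ K →
      (∀ x, ‖g x - h x‖ ≤ K * φ x) → ∀ x, ‖f g x - f h x‖ ≤ K / 2 * φ x) :
    ∃ h, f h = h := by
  have hn : ∀ (n : ℕ) (g h : BoundedContinuousFunction X E) (x : X),
      ‖f^[n] g x - f^[n] h x‖ ≤ dist g h * (1 / 2) ^ n * φ x := by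
    intro n g h
    induction n with
    | zero =>
      intro x
      have h1 := BoundedContinuousFunction.dist_coe_le_dist (f := g) (g := h) x
      rw [dist_eq_norm] at h1
      simp only [Function.iterate_zero, id_eq, pow_zero, mul_one]
      nlinarith [hφ x, dist_nonneg (x := g) (y := h)]
    | succ n ih =>
      intro x
      have := hf _ _ _ (by positivity) ih x
      rw [Function.iterate_succ_apply', Function.iterate_succ_apply', pow_succ]
      linarith
  -- Passing from weighted bounds back to the sup norm costs a factor `M`, which enough halvings
  -- absorb. The `max` covers an empty `X`, where `M` may be negative.
  obtain ⟨n, hn'⟩ : ∃ n : ℕ, (1 / 2 : ℝ) ^ n * max M 0 < 1 / 2 := by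
    have hlim : Tendsto (fun n : ℕ => (1 / 2 : ℝ) ^ n * max M 0) atTop (𝓝 (0 * max M 0)) :=
      (tendsto_pow_atTop_nhds_zero_of_lt_one (by norm_num) (by norm_num)).mul_const _
    rw [zero_mul] at hlim
    exact (hlim.eventually_lt_const (by norm_num)).exists
  have hc : ContractingWith (1 / 2) f^[n] := by
    refine ⟨by rw [← NNReal.coe_lt_coe]; norm_num, LipschitzWith.of_dist_le_mul fun g h => ?_⟩
    rw [BoundedContinuousFunction.dist_le (by positivity)]
    intro x
    rw [dist_eq_norm]
    refine (hn n g h x).trans ?_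
    have h1 : φ x ≤ max M 0 := (hM x).trans (le_max_left _ _)
    have h2 : dist g h * (1 / 2) ^ n * φ x ≤ dist g h * ((1 / 2) ^ n * max M 0) := by
      rw [mul_assoc]; gcongr
    refine h2.trans ?_
    have : dist g h * ((1 / 2) ^ n * max M 0) ≤ dist g h * (1 / 2) := by gcongr
    push_cast
    linarith
  -- `f` maps the fixed point of its iterate to another fixed point of that iterate, so uniqueness
  -- makes it fixed by `f`.
  exact ⟨_, hc.isFixedPt_fixedPoint_iterate⟩

/-! ### Weighted estimates for kernels of size `C / (1 + z)²` -/

/-- The weight adapted to kernels of size `C / (1 + z)²`. -/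
noncomputable def weight (C z : ℝ) : ℝ := Real.exp (2 * C / (1 + z))

theorem one_le_weight {C z : ℝ} (hC : 0 ≤ C) (hz : 0 ≤ z) : 1 ≤ weight C z :=
  Real.one_le_exp (by positivity)

theorem weight_le {C z : ℝ} (hC : 0 ≤ C) (hz : 0 ≤ z) : weight C z ≤ Real.exp (2 * C) := by
  refine Real.exp_le_exp.2 (div_le_self (by positivity) (by linarith))

theorem tendsto_div_one_add_atTop (C : ℝ) : Tendsto (fun z : ℝ => C / (1 + z)) atTop (𝓝 0) :=
  tendsto_const_nhds.div_atTop (tendsto_atTop_add_const_left _ _ tendsto_id)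

theorem hasDerivAt_div_one_add (C : ℝ) {x : ℝ} (hx : 0 ≤ x) :
    HasDerivAt (fun z : ℝ => C / (1 + z)) (-(C / (1 + x) ^ 2)) x := by
  have h1 : HasDerivAt (fun z : ℝ => 1 + z) 1 x := (hasDerivAt_id x).const_add 1
  have := (hasDerivAt_const x C).div h1 (by positivity)
  simp only [zero_mul, mul_one, zero_sub, neg_div] at this
  exact this

theorem integrableOn_div_sq {C z : ℝ} (hC : 0 ≤ C) (hz : 0 ≤ z) :
    IntegrableOn (fun ζ : ℝ => C / (1 + ζ) ^ 2) (Ioi z) := by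
  have := integrableOn_Ioi_deriv_of_nonpos' (g := fun z : ℝ => C / (1 + z)) (a := z)
    (fun x hx => hasDerivAt_div_one_add C (hz.trans hx)) (fun x hx => by
      have : 0 ≤ C / (1 + x) ^ 2 := by positivity
      linarith) (tendsto_div_one_add_atTop C)
  simpa using this.neg

theorem integral_div_sq {C z : ℝ} (hC : 0 ≤ C) (hz : 0 ≤ z) :
    ∫ ζ in Ioi z, C / (1 + ζ) ^ 2 = C / (1 + z) := by
  have := integral_Ioi_of_hasDerivAt_of_tendsto' (f := fun z : ℝ => C / (1 + z)) (a := z)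
    (fun x hx => hasDerivAt_div_one_add C (hz.trans hx)) (integrableOn_div_sq hC hz).neg
    (tendsto_div_one_add_atTop C)
  simp only [integral_neg, zero_sub, neg_inj] at this
  exact this

/-- The weight `w` satisfies `w' = -2C/(1+z)² · w`, so `-w/2` is a primitive of the integrand, with
limit `-1/2` at infinity. The `2` in the exponent of `w` is what produces the factor one half. -/
theorem integrableOn_div_sq_mul_weight {C z : ℝ} (hC : 0 ≤ C) (hz : 0 ≤ z) :
    IntegrableOn (fun ζ : ℝ => C / (1 + ζ) ^ 2 * weight C ζ) (Ioi z) ∧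
      ∫ ζ in Ioi z, C / (1 + ζ) ^ 2 * weight C ζ ≤ weight C z / 2 := by
  have hd : ∀ x ∈ Ici z, HasDerivAt (fun ζ => -(weight C ζ / 2))
      (C / (1 + x) ^ 2 * weight C x) x := by
    intro x hx
    have := ((hasDerivAt_div_one_add (2 * C) (hz.trans hx)).exp.div_const 2).neg
    exact this.congr_deriv (by unfold weight; ring)
  have hl : Tendsto (fun ζ => -(weight C ζ / 2)) atTop (𝓝 (-(1 / 2))) := by
    have := ((Real.continuous_exp.tendsto _).comp (tendsto_div_one_add_atTop (2 * C)))
    rw [Real.exp_zero] at this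
    exact (this.div_const 2).neg
  have hp : ∀ x ∈ Ioi z, 0 ≤ C / (1 + x) ^ 2 * weight C x := fun x hx => by
    unfold weight; positivity
  refine ⟨integrableOn_Ioi_deriv_of_nonneg' hd hp hl, ?_⟩
  rw [integral_Ioi_of_hasDerivAt_of_nonneg' hd hp hl]
  linarith

/-- The basic estimate for Volterra operators with kernel of size `C / (1 + ζ)²`. -/
theorem norm_integral_Ioi_le_half_weight {E : Type*} [NormedAddCommGroup E] [NormedSpace ℝ E]
    {C K z : ℝ} (hC : 0 ≤ C) (hK : 0 ≤ K) (hz : 0 ≤ z) {F : ℝ → E}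
    (hF : ∀ ζ ∈ Ioi z, ‖F ζ‖ ≤ C / (1 + ζ) ^ 2 * (K * weight C ζ)) :
    ‖∫ ζ in Ioi z, F ζ‖ ≤ K / 2 * weight C z := by
  obtain ⟨hi, hb⟩ := integrableOn_div_sq_mul_weight hC hz
  calc ‖∫ ζ in Ioi z, F ζ‖ ≤ ∫ ζ in Ioi z, K * (C / (1 + ζ) ^ 2 * weight C ζ) := by
        refine norm_integral_le_of_norm_le (hi.const_mul K) ?_
        refine (ae_restrict_mem measurableSet_Ioi).mono fun ζ hζ => (hF ζ hζ).trans (le_of_eq ?_)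
        ring
    _ ≤ K / 2 * weight C z := by
        rw [integral_const_mul]
        nlinarith

/-- The same estimate without the weight. -/
theorem norm_integral_Ioi_le_div {E : Type*} [NormedAddCommGroup E] [NormedSpace ℝ E]
    {C z : ℝ} (hC : 0 ≤ C) (hz : 0 ≤ z) {F : ℝ → E}
    (hF : ∀ ζ ∈ Ioi z, ‖F ζ‖ ≤ C / (1 + ζ) ^ 2) :
    ‖∫ ζ in Ioi z, F ζ‖ ≤ C / (1 + z) := by
  rw [← integral_div_sq hC hz]
  exact norm_integral_le_of_norm_le (integrableOn_div_sq hC hz)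
    ((ae_restrict_mem measurableSet_Ioi).mono fun ζ hζ => hF ζ hζ)

theorem integrableOn_Ioi_of_le_div {E : Type*} [NormedAddCommGroup E] {C z : ℝ} (hC : 0 ≤ C)
    (hz : 0 ≤ z) {F : ℝ → E} (hc : ContinuousOn F (Ioi z))
    (hF : ∀ ζ ∈ Ioi z, ‖F ζ‖ ≤ C / (1 + ζ) ^ 2) : IntegrableOn F (Ioi z) :=
  (integrableOn_div_sq hC hz).mono' (hc.aestronglyMeasurable measurableSet_Ioi)
    ((ae_restrict_mem measurableSet_Ioi).mono fun ζ hζ => hF ζ hζ)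

/-- Moves the dependence on `z` from the domain into the integrand, so that continuity in `z`
follows from dominated convergence on a fixed half-line. -/
theorem setIntegral_Ioi_eq_translate {E : Type*} [NormedAddCommGroup E] [NormedSpace ℝ E]
    (F : ℝ → E) (z : ℝ) : ∫ ζ in Ioi z, F ζ = ∫ x in Ioi (0 : ℝ), F (z + x) := by
  have h := (measurePreserving_add_left (volume : Measure ℝ) z).setIntegral_preimage_emb
    (measurableEmbedding_addLeft z) F (Ioi z)
  simpa using h.symm

/-- Differentiation under the integral sign. -/
theorem hasDerivAt_intervalIntegral_param {E : Type*} [NormedAddCommGroup E] [NormedSpace ℝ E]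
    {f f' : ℝ × ℝ → E} (hf : Continuous f) (hf' : Continuous f')
    {T t z : ℝ} (hz : 0 < z) (ht : t ∈ Icc 0 T)
    (hd : ∀ ζ τ : ℝ, 0 < ζ → τ ∈ Ioo 0 T → HasDerivAt (fun x => f (x, τ)) (f' (ζ, τ)) ζ) :
    HasDerivAt (fun x => ∫ τ in (0 : ℝ)..t, f (x, τ)) (∫ τ in (0 : ℝ)..t, f' (z, τ)) z := by
  -- The neighbourhood `[z/2, 2z]` is compact and stays inside `z > 0`, where the derivative is
  -- known.
  obtain ⟨C, hC⟩ := ((isCompact_Icc (a := z / 2) (b := 2 * z)).prod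
    (isCompact_Icc (a := (0 : ℝ)) (b := t))).exists_bound_of_continuousOn hf'.continuousOn
  refine (intervalIntegral.hasDerivAt_integral_of_dominated_loc_of_deriv_le
    (F := fun x τ => f (x, τ)) (F' := fun x τ => f' (x, τ)) (bound := fun _ => C)
    (s := Icc (z / 2) (2 * z)) (Icc_mem_nhds (by linarith) (by linarith))
    (Eventually.of_forall fun x => ?_) ?_ ?_ ?_ ?_ ?_).2
  · exact (Continuous.aestronglyMeasurable (by fun_prop)).restrict
  · exact Continuous.intervalIntegrable (by fun_prop) _ _
  · exact (Continuous.aestronglyMeasurable (by fun_prop)).restrict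
  · refine Eventually.of_forall fun τ hτ x hx => hC _ ⟨hx, ?_⟩
    rw [uIoc_of_le ht.1] at hτ
    exact ⟨hτ.1.le, hτ.2⟩
  · exact intervalIntegrable_const
  -- The derivative is only available for `τ < T`, while `t = T` is allowed; the endpoint is a null
  -- set.
  · have hne : ∀ᵐ τ : ℝ, τ ≠ t := by
      simp [ae_iff]
    filter_upwards [hne] with τ hne hτ x hx
    rw [uIoc_of_le ht.1] at hτ
    exact hd x τ (by linarith [hx.1]) ⟨hτ.1, (lt_of_le_of_ne hτ.2 hne).trans_le ht.2⟩

/-! ### Solvability and uniqueness of the half-line Volterra equation -/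

section Volterra

variable {E : Type*} [NormedAddCommGroup E] [NormedSpace ℝ E]

theorem norm_clm_comp_apply_le {D a : E →L[ℝ] E} {v : E} {c k : ℝ} (hD : ‖D‖ ≤ 1) (ha : ‖a‖ ≤ c)
    (hv : ‖v‖ ≤ k) : ‖D (a v)‖ ≤ c * k := by
  have h1 := D.le_of_opNorm_le hD (a v)
  have h2 := a.le_of_opNorm_le ha v
  have h3 : 0 ≤ c := (norm_nonneg _).trans ha
  nlinarith [mul_le_mul_of_nonneg_left hv h3]

/-- The Volterra equation on the half-line, with continuous dependence on a parameter. -/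
theorem exists_volterra_solution [CompleteSpace E] {D : ℝ → E →L[ℝ] E} (hD : Continuous D)
    (hD1 : ∀ x, 0 ≤ x → ‖D x‖ ≤ 1) {a : ℝ × ℝ → E →L[ℝ] E} (ha : Continuous a) {C : ℝ}
    (hC : 0 ≤ C) (hb : ∀ p : ℝ × ℝ, 0 ≤ p.1 → ‖a p‖ ≤ C / (1 + p.1) ^ 2) (v : E) :
    ∃ h : ℝ × ℝ → E, Continuous h ∧ (∃ K, ∀ p, ‖h p‖ ≤ K) ∧
      ∀ z t : ℝ, 0 ≤ z → h (z, t) = v - ∫ ζ in Ioi z, D (ζ - z) (a (ζ, t) (h (ζ, t))) := by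
  -- Here `ζ = z + x`, and `z` is replaced by `max z 0`, so the fixed point problem lives on the
  -- whole plane while the kernel bound is used only where it holds.
  let F : BoundedContinuousFunction (ℝ × ℝ) E → ℝ × ℝ → ℝ → E := fun h p x =>
    D x (a (max p.1 0 + x, p.2) (h (max p.1 0 + x, p.2)))
  have hFc : ∀ h, Continuous (fun q : (ℝ × ℝ) × ℝ => F h q.1 q.2) := fun h => by
    have hm : Continuous fun q : (ℝ × ℝ) × ℝ => (max q.1.1 0 + q.2, q.1.2) := by fun_prop
    exact (hD.comp continuous_snd).clm_apply ((ha.comp hm).clm_apply (h.continuous.comp hm))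
  have hFb : ∀ h p x, 0 ≤ x → ‖F h p x‖ ≤ C * ‖h‖ / (1 + x) ^ 2 := fun h p x hx => by
    have hz : 0 ≤ max p.1 0 := le_max_right _ _
    refine (norm_clm_comp_apply_le (hD1 x hx) (hb _ (by positivity)) (h.norm_coe_le_norm _)).trans ?_
    simp only
    rw [div_mul_eq_mul_div]
    gcongr
    linarith
  have hFi : ∀ h p, IntegrableOn (F h p) (Ioi 0) := fun h p =>
    integrableOn_Ioi_of_le_div (by positivity) le_rfl
      ((hFc h).comp (Continuous.prodMk_right p)).continuousOn fun x hx => hFb h p x hx.le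
  have hint : ∀ h, Continuous fun p => ∫ x in Ioi (0 : ℝ), F h p x := fun h => by
    refine continuous_of_dominated (bound := fun x => C * ‖h‖ / (1 + x) ^ 2)
      (fun p => (hFi h p).aestronglyMeasurable) (fun p => ?_)
      (integrableOn_div_sq (by positivity) le_rfl) (Eventually.of_forall fun x => ?_)
    · exact (ae_restrict_mem measurableSet_Ioi).mono fun x hx => hFb h p x (le_of_lt hx)
    · exact (hFc h).comp (Continuous.prodMk_left x)
  let f : BoundedContinuousFunction (ℝ × ℝ) E → BoundedContinuousFunction (ℝ × ℝ) E := fun h =>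
    BoundedContinuousFunction.ofNormedAddCommGroup (fun p => v - ∫ x in Ioi (0 : ℝ), F h p x)
      (continuous_const.sub (hint h)) (‖v‖ + C * ‖h‖) fun p => by
        refine (norm_sub_le _ _).trans ?_
        gcongr
        simpa using norm_integral_Ioi_le_div (C := C * ‖h‖) (z := 0) (by positivity) le_rfl
          fun x hx => hFb h p x (le_of_lt hx)
  obtain ⟨h, hh⟩ := exists_fixedPoint_of_halving f (φ := fun p => weight C (max p.1 0))
    (fun p => one_le_weight hC (le_max_right _ _)) (fun p => weight_le hC (le_max_right _ _))
    (fun g h K hK hgh p => by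
      have hz : 0 ≤ max p.1 0 := le_max_right _ _
      have e1 : f g p - f h p = ∫ x in Ioi (0 : ℝ), (F h p x - F g p x) := by
        rw [integral_sub (hFi h p) (hFi g p)]
        simp [f]
      have e2 : ∀ x, F h p x - F g p x = (fun ζ => D (ζ - max p.1 0)
          (a (ζ, p.2) (h (ζ, p.2) - g (ζ, p.2)))) (max p.1 0 + x) := fun x => by
        simp [F]
      simp only [e2] at e1
      rw [e1, ← setIntegral_Ioi_eq_translate (fun ζ => D (ζ - max p.1 0)
          (a (ζ, p.2) (h (ζ, p.2) - g (ζ, p.2)))) (max p.1 0)]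
      refine norm_integral_Ioi_le_half_weight hC hK hz fun ζ hζ => ?_
      have hζ0 : 0 ≤ ζ := hz.trans (le_of_lt hζ)
      refine norm_clm_comp_apply_le (hD1 _ (sub_nonneg.2 (le_of_lt hζ))) (hb _ hζ0) ?_
      rw [norm_sub_rev]
      simpa [max_eq_left hζ0] using hgh (ζ, p.2))
  refine ⟨h, h.continuous, ⟨‖h‖, h.norm_coe_le_norm⟩, fun z t hz => ?_⟩
  have := DFunLike.congr_fun hh (z, t)
  rw [← this]
  change v - _ = v - _
  rw [setIntegral_Ioi_eq_translate (fun ζ => D (ζ - z) (a (ζ, t) (h (ζ, t)))) z]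
  simp [F, max_eq_left hz]

/-- Uniqueness for the Volterra equation on the half-line. -/
theorem volterra_unique {D : ℝ → E →L[ℝ] E} (hD : Continuous D)
    (hD1 : ∀ x, 0 ≤ x → ‖D x‖ ≤ 1) {a : ℝ → E →L[ℝ] E} (ha : ContinuousOn a (Ici 0)) {C : ℝ}
    (hC : 0 ≤ C) (hb : ∀ z, 0 ≤ z → ‖a z‖ ≤ C / (1 + z) ^ 2) (v : E) {g h : ℝ → E}
    (hg : ContinuousOn g (Ici 0)) (hh : ContinuousOn h (Ici 0))
    (hgb : ∃ K, ∀ z ∈ Ici (0 : ℝ), ‖g z‖ ≤ K) (hhb : ∃ K, ∀ z ∈ Ici (0 : ℝ), ‖h z‖ ≤ K)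
    (hge : ∀ z ∈ Ici (0 : ℝ), g z = v - ∫ ζ in Ioi z, D (ζ - z) (a ζ (g ζ)))
    (hhe : ∀ z ∈ Ici (0 : ℝ), h z = v - ∫ ζ in Ioi z, D (ζ - z) (a ζ (h ζ))) :
    EqOn g h (Ici 0) := by
  obtain ⟨K₁, h₁⟩ := hgb
  obtain ⟨K₂, h₂⟩ := hhb
  have p₁ : 0 ≤ K₁ := (norm_nonneg _).trans (h₁ 0 self_mem_Ici)
  have p₂ : 0 ≤ K₂ := (norm_nonneg _).trans (h₂ 0 self_mem_Ici)
  have hi : ∀ (k : ℝ → E) (K : ℝ), 0 ≤ K → ContinuousOn k (Ici 0) →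
      (∀ z ∈ Ici (0 : ℝ), ‖k z‖ ≤ K) → ∀ z, 0 ≤ z →
      IntegrableOn (fun ζ => D (ζ - z) (a ζ (k ζ))) (Ioi z) := by
    intro k K hK hk hkb z hz
    refine integrableOn_Ioi_of_le_div (C := C * K) (by positivity) hz ?_ fun ζ hζ => ?_
    · have hs : Ioi z ⊆ Ici 0 := fun x hx => hz.trans (le_of_lt hx)
      exact (Continuous.continuousOn (by fun_prop)).clm_apply ((ha.mono hs).clm_apply (hk.mono hs))
    · have hζ0 : 0 ≤ ζ := hz.trans (le_of_lt hζ)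
      refine (norm_clm_comp_apply_le (hD1 _ (sub_nonneg.2 (le_of_lt hζ))) (hb _ hζ0)
        (hkb ζ hζ0)).trans (le_of_eq (by ring))
  have key := eq_zero_of_halving (g := fun z => g z - h z) (φ := weight C) (S := Ici 0)
    (K₀ := K₁ + K₂) (by positivity) (fun z hz => by
      have := one_le_weight hC hz
      have := norm_sub_le (g z) (h z)
      nlinarith [h₁ z hz, h₂ z hz]) (fun K hK hs z hz => by
      have e : g z - h z = ∫ ζ in Ioi z, D (ζ - z) (a ζ (h ζ - g ζ)) := by
        simp only [map_sub]
        rw [integral_sub (hi h K₂ p₂ hh h₂ z hz) (hi g K₁ p₁ hg h₁ z hz), hge z hz, hhe z hz]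
        abel
      simp only [e]
      refine norm_integral_Ioi_le_half_weight hC hK hz fun ζ hζ => ?_
      have hζ0 : 0 ≤ ζ := le_trans hz (le_of_lt hζ)
      refine norm_clm_comp_apply_le (hD1 _ (sub_nonneg.2 (le_of_lt hζ))) (hb _ hζ0) ?_
      rw [norm_sub_rev]
      exact hs ζ hζ0)
  exact fun z hz => sub_eq_zero.1 (key z hz)

end Volterra

/-! ### From the integral equation to the two differential equations -/

section Evolution

variable {E : Type*} [NormedAddCommGroup E] [NormedSpace ℝ E]

/-- A contraction semigroup `D x = exp (-x Λ)`, extended to a group, that fixes the vector `v`. -/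
structure IsContractionGroup (D : ℝ → E →L[ℝ] E) (Λ : E →L[ℝ] E) (v : E) : Prop where
  norm_le : ∀ x, 0 ≤ x → ‖D x‖ ≤ 1
  zero : D 0 = 1
  add : ∀ x y, D (x + y) = D x * D y
  hasDerivAt : ∀ x, HasDerivAt D (-(Λ * D x)) x
  comm : ∀ x, Λ * D x = D x * Λ
  map_eq_zero : Λ v = 0

variable {D : ℝ → E →L[ℝ] E} {Λ : E →L[ℝ] E} {v : E}

theorem IsContractionGroup.continuous (hD : IsContractionGroup D Λ v) : Continuous D :=
  continuous_iff_continuousAt.2 fun x => (hD.hasDerivAt x).continuousAt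

/-- A solution of the Volterra equation solves the differential equation. -/
theorem IsContractionGroup.hasDerivAt_of_volterra [CompleteSpace E]
    (hD : IsContractionGroup D Λ v) {a : ℝ → E →L[ℝ] E} (ha : Continuous a) {C K : ℝ} (hC : 0 ≤ C)
    (hb : ∀ z, 0 ≤ z → ‖a z‖ ≤ C / (1 + z) ^ 2) {h : ℝ → E} (hh : Continuous h)
    (hK : ∀ z, ‖h z‖ ≤ K)
    (he : ∀ z, 0 ≤ z → h z = v - ∫ ζ in Ioi z, D (ζ - z) (a ζ (h ζ))) {z : ℝ} (hz : 0 < z) :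
    HasDerivAt h (Λ (h z) + a z (h z)) z := by
  have hK0 : 0 ≤ K := (norm_nonneg _).trans (hK 0)
  have hg : Continuous fun ζ => D ζ (a ζ (h ζ)) := hD.continuous.clm_apply (ha.clm_apply hh)
  have hi : IntegrableOn (fun ζ => D ζ (a ζ (h ζ))) (Ioi 0) := by
    refine integrableOn_Ioi_of_le_div (C := C * K) (by positivity) le_rfl hg.continuousOn
      fun ζ hζ => ?_
    exact (norm_clm_comp_apply_le (hD.norm_le _ (le_of_lt hζ)) (hb _ (le_of_lt hζ))
      (hK ζ)).trans (le_of_eq (by ring))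
  have hinv : ∀ x, D (-x) * D x = 1 := fun x => by rw [← hD.add, neg_add_cancel, hD.zero]
  -- The group law `D (ζ - x) = D (-x) D ζ` takes `x` out of the integrand, leaving it in a group
  -- element and an integration limit. No bound on `D (-x)` is needed.
  have hJ : ∀ x : ℝ, 0 ≤ x → h x = v - D (-x) ((∫ ζ in Ioi (0 : ℝ), D ζ (a ζ (h ζ)))
      - ∫ ζ in (0 : ℝ)..x, D ζ (a ζ (h ζ))) := fun x hx => by
    have hsub : Ioi x ⊆ Ioi 0 := Ioi_subset_Ioi hx
    rw [intervalIntegral.integral_of_le hx, ← Ioc_union_Ioi_eq_Ioi hx, setIntegral_union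
      (Ioc_disjoint_Ioi le_rfl) measurableSet_Ioi (hi.mono_set Ioc_subset_Ioi_self)
      (hi.mono_set hsub), add_sub_cancel_left,
      ← ContinuousLinearMap.integral_comp_comm _ (hi.mono_set hsub), he x hx]
    congr 2
    ext ζ
    rw [sub_eq_neg_add, hD.add]
    rfl
  have hJd : HasDerivAt (fun x => (∫ ζ in Ioi (0 : ℝ), D ζ (a ζ (h ζ)))
      - ∫ ζ in (0 : ℝ)..x, D ζ (a ζ (h ζ))) (-(D z (a z (h z)))) z :=
    (intervalIntegral.integral_hasDerivAt_right (hg.intervalIntegrable _ _)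
      (hg.stronglyMeasurableAtFilter _ _) hg.continuousAt).const_sub _
  have hDd : HasDerivAt (fun x => D (-x)) (Λ * D (-z)) z := by
    have : HasDerivAt (fun x => D (-x)) ((-1 : ℝ) • -(Λ * D (-z))) z :=
      (hD.hasDerivAt (-z)).scomp z (hasDerivAt_neg z)
    exact this.congr_deriv (by simp)
  have hd := (hDd.clm_apply hJd).const_sub v
  have hev : h =ᶠ[𝓝 z] fun x => v - D (-x) ((∫ ζ in Ioi (0 : ℝ), D ζ (a ζ (h ζ)))
      - ∫ ζ in (0 : ℝ)..x, D ζ (a ζ (h ζ))) :=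
    (eventually_gt_nhds hz).mono fun x hx => hJ x hx.le
  refine (hd.congr_of_eventuallyEq hev).congr_deriv ?_
  have h1 := congrArg Λ (hJ z hz.le)
  have h2 : D (-z) (D z (a z (h z))) = a z (h z) := by
    rw [← mul_apply_eq_comp, hinv, one_apply_eq_self]
  rw [map_sub, hD.map_eq_zero] at h1
  rw [h1, map_neg, h2, mul_apply_eq_comp]
  abel

/-- **Compatibility.** If `X = Λ + a` and `Y` satisfy the zero curvature equation, then the solution
of `h_z = X h` normalised by `h → v` at infinity also satisfies `h_t = Y h`, provided `Y` tends to a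
constant that annihilates `v`. -/
theorem IsContractionGroup.evolution [CompleteSpace E] (hD : IsContractionGroup D Λ v) {T : ℝ}
    {a a' Y : ℝ × ℝ → E →L[ℝ] E} (ha : Continuous a) (ha' : Continuous a') (hY : Continuous Y)
    {C : ℝ} (hC : 0 ≤ C) (hb : ∀ p : ℝ × ℝ, 0 ≤ p.1 → ‖a p‖ ≤ C / (1 + p.1) ^ 2)
    (hb' : ∀ p : ℝ × ℝ, 0 ≤ p.1 → ‖a' p‖ ≤ C / (1 + p.1) ^ 2) {N : E →L[ℝ] E} (hN : N v = 0)
    (hYN : ∀ p : ℝ × ℝ, 0 ≤ p.1 → ‖Y p - N‖ ≤ C / (1 + p.1))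
    (hda : ∀ z t : ℝ, 0 < z → t ∈ Ioo 0 T → HasDerivAt (fun τ => a (z, τ)) (a' (z, t)) t)
    (hdY : ∀ z t : ℝ, 0 < z → t ∈ Ioo 0 T → HasDerivAt (fun x => Y (x, t))
      (a' (z, t) + (Λ + a (z, t)) * Y (z, t) - Y (z, t) * (Λ + a (z, t))) z)
    {h : ℝ × ℝ → E} (hh : Continuous h) {K : ℝ} (hK : ∀ p, ‖h p‖ ≤ K)
    (he : ∀ z t : ℝ, 0 ≤ z → h (z, t) = v - ∫ ζ in Ioi z, D (ζ - z) (a (ζ, t) (h (ζ, t))))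
    {z t : ℝ} (hz : 0 ≤ z) (ht : t ∈ Icc 0 T) :
    h (z, t) = h (z, 0) + ∫ τ in (0 : ℝ)..t, Y (z, τ) (h (z, τ)) := by
  have hK0 : 0 ≤ K := (norm_nonneg _).trans (hK 0)
  have hT : 0 ≤ T := ht.1.trans ht.2
  have hYh : Continuous fun p => Y p (h p) := hY.clm_apply hh
  -- `L` is what `h` would be if it evolved by `Y`; its `τ`-derivative exists by construction,
  -- unlike that of `h`.
  let L : ℝ × ℝ → E := fun p => h (p.1, 0) + ∫ τ in (0 : ℝ)..p.2, Y (p.1, τ) (h (p.1, τ))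
  have hL : Continuous L := by
    refine Continuous.add (by fun_prop)
      (intervalIntegral.continuous_parametric_intervalIntegral_of_continuous ?_ continuous_snd)
    exact hYh.comp (by fun_prop : Continuous fun q : (ℝ × ℝ) × ℝ => (q.1.1, q.2))
  let e : ℝ × ℝ → E := fun p => h p - L p
  have hec : Continuous e := hh.sub hL
  -- The first term bounds `h(x,s) - h(x,0)`, both within `CK/(1+x)` of `v`; the second bounds `∫ Y
  -- h` over a time at most `T`.
  let M : ℝ := 2 * (C * K) + T * (‖N‖ * (C * K) + C * K)
  have hM : 0 ≤ M := by positivity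
  have hv : ∀ x s : ℝ, 0 ≤ x → ‖h (x, s) - v‖ ≤ C * K / (1 + x) := fun x s hx => by
    rw [he x s hx, sub_sub_cancel_left, norm_neg]
    refine norm_integral_Ioi_le_div (by positivity) hx fun ζ hζ => ?_
    exact (norm_clm_comp_apply_le (hD.norm_le _ (sub_nonneg.2 (le_of_lt hζ)))
      (hb (ζ, s) (hx.trans (le_of_lt hζ))) (hK _)).trans (le_of_eq (by ring))
  have heb : ∀ x s : ℝ, 0 ≤ x → s ∈ Icc 0 T → ‖e (x, s)‖ ≤ M / (1 + x) := fun x s hx hs => by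
    have h1 : ‖h (x, s) - h (x, 0)‖ ≤ 2 * (C * K) / (1 + x) := by
      rw [← sub_sub_sub_cancel_right _ _ v]
      refine (norm_sub_le _ _).trans ?_
      have := hv x s hx
      have := hv x 0 hx
      rw [mul_div_assoc]
      linarith
    have h2 : ‖∫ τ in (0 : ℝ)..s, Y (x, τ) (h (x, τ))‖ ≤
        (‖N‖ * (C * K) + C * K) / (1 + x) * |s - 0| := by
      refine intervalIntegral.norm_integral_le_of_norm_le_const fun τ _ => ?_
      -- Because `N v = 0`, both summands are small at infinity: the first since `h → v`, the second
      -- since `Y → N`.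
      have h3 : Y (x, τ) (h (x, τ)) = N (h (x, τ) - v) + (Y (x, τ) - N) (h (x, τ)) := by
        simp [hN]
      rw [h3]
      refine (norm_add_le _ _).trans ?_
      have h4 := N.le_opNorm_of_le (hv x τ hx)
      have h5 := ((Y (x, τ) - N).le_of_opNorm_le (hYN (x, τ) hx) (h (x, τ)))
      have h6 : C / (1 + x) * ‖h (x, τ)‖ ≤ C / (1 + x) * K := by
        gcongr
        exact hK _
      have h7 : (‖N‖ * (C * K) + C * K) / (1 + x) =
        ‖N‖ * (C * K / (1 + x)) + C / (1 + x) * K := by ring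
      simp only at h5
      linarith
    have h8 : e (x, s) = h (x, s) - h (x, 0) - ∫ τ in (0 : ℝ)..s, Y (x, τ) (h (x, τ)) := by
      simp [e, L, sub_sub]
    rw [h8]
    refine (norm_sub_le _ _).trans ?_
    rw [sub_zero, abs_of_nonneg hs.1] at h2
    have h9 : (‖N‖ * (C * K) + C * K) / (1 + x) * s ≤
        (‖N‖ * (C * K) + C * K) / (1 + x) * T := by
      gcongr
      exact hs.2
    have h10 : M / (1 + x) = 2 * (C * K) / (1 + x) +
      (‖N‖ * (C * K) + C * K) / (1 + x) * T := by simp only [M]; ring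
    linarith
  have hhd : ∀ x s : ℝ, 0 < x → HasDerivAt (fun y => h (y, s)) ((Λ + a (x, s)) (h (x, s))) x :=
    fun x s hx => hD.hasDerivAt_of_volterra (a := fun y => a (y, s)) (h := fun y => h (y, s))
      (C := C) (K := K) (by fun_prop) hC (fun y hy => hb (y, s) hy) (by fun_prop)
      (fun y => hK _) (fun y hy => he y s hy) hx
  let G : ℝ × ℝ → E := fun p => a p (e p) - ∫ τ in (0 : ℝ)..p.2, a' (p.1, τ) (e (p.1, τ))
  have hG : Continuous G := by
    refine (ha.clm_apply hec).sub
      (intervalIntegral.continuous_parametric_intervalIntegral_of_continuous ?_ continuous_snd)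
    exact (ha'.clm_apply hec).comp (by fun_prop : Continuous fun q : (ℝ × ℝ) × ℝ => (q.1.1, q.2))
  have hed : ∀ x s : ℝ, 0 < x → s ∈ Icc 0 T →
      HasDerivAt (fun y => e (y, s)) (Λ (e (x, s)) + G (x, s)) x := fun x s hx hs => by
    have hXY : Continuous fun p => a' p (h p) + (Λ + a p) (Y p (h p)) :=
      (ha'.clm_apply hh).add ((continuous_const.add ha).clm_apply hYh)
    -- Zero curvature: in `(Y h)_z` the terms `Y X h` cancel, leaving `a' h + X Y h`, where `X = Λ +
    -- a`.
    have d1 := hasDerivAt_intervalIntegral_param (T := T) hYh hXY hx hs fun ζ τ hζ hτ =>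
      ((hdY ζ τ hζ hτ).clm_apply (hhd ζ τ hζ)).congr_deriv (by simp)
    have d2 := (hhd x s hx).sub ((hhd x 0 hx).add d1)
    refine d2.congr_deriv ?_
    have hLτ : ∀ τ : ℝ, HasDerivAt (fun τ => L (x, τ)) (Y (x, τ) (h (x, τ))) τ := fun τ => by
      have hc : Continuous fun τ => Y (x, τ) (h (x, τ)) := hYh.comp (Continuous.prodMk_right x)
      exact (intervalIntegral.integral_hasDerivAt_right (hc.intervalIntegrable _ _)
        (hc.stronglyMeasurableAtFilter _ _) hc.continuousAt).const_add (h (x, 0))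
    have hXL : Continuous fun p => a' p (L p) + (Λ + a p) (Y p (h p)) :=
      (ha'.clm_apply hL).add ((continuous_const.add ha).clm_apply hYh)
    -- Since `L_τ = Y h`, the integrand is `(X L)_τ`. Subtracting it removes `X Y h` from the
    -- `z`-derivative of the integral and leaves only `a' e`.
    have d3 : ∫ τ in (0 : ℝ)..s, (a' (x, τ) (L (x, τ)) + (Λ + a (x, τ)) (Y (x, τ) (h (x, τ)))) =
        (Λ + a (x, s)) (L (x, s)) - (Λ + a (x, 0)) (L (x, 0)) := by
      refine intervalIntegral.integral_eq_sub_of_hasDerivAt_of_le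
        (f := fun τ => (Λ + a (x, τ)) (L (x, τ))) hs.1 ?_ (fun τ hτ => ?_) ?_
      · exact (((continuous_const.add ha).clm_apply hL).comp
          (Continuous.prodMk_right x)).continuousOn
      · exact ((hda x τ hx ⟨hτ.1, hτ.2.trans_le hs.2⟩).const_add Λ).clm_apply (hLτ τ)
      · exact (hXL.comp (Continuous.prodMk_right x)).intervalIntegrable _ _
    have hL0 : L (x, 0) = h (x, 0) := by simp [L]
    have d4 : ∫ τ in (0 : ℝ)..s, a' (x, τ) (e (x, τ)) =
        (∫ τ in (0 : ℝ)..s, (a' (x, τ) (h (x, τ)) + (Λ + a (x, τ)) (Y (x, τ) (h (x, τ))))) -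
        ∫ τ in (0 : ℝ)..s, (a' (x, τ) (L (x, τ)) + (Λ + a (x, τ)) (Y (x, τ) (h (x, τ)))) := by
      refine Eq.trans ?_ (intervalIntegral.integral_sub
        ((hXY.comp (Continuous.prodMk_right x)).intervalIntegrable _ _)
        ((hXL.comp (Continuous.prodMk_right x)).intervalIntegrable _ _))
      simp [e]
    rw [d3, hL0] at d4
    simp only [G, d4]
    simp only [e, _root_.add_apply, map_sub]
    abel
  have hGb : ∀ (x s k : ℝ), 0 ≤ x → s ∈ Icc 0 T → 0 ≤ k → (∀ τ ∈ Icc 0 T, ‖e (x, τ)‖ ≤ k) →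
      ‖G (x, s)‖ ≤ C * (1 + T) / (1 + x) ^ 2 * k := fun x s k hx hs hk hek => by
    have h1 := (a (x, s)).le_of_opNorm_le_of_le (hb (x, s) hx) (hek s hs)
    have h2 : ‖∫ τ in (0 : ℝ)..s, a' (x, τ) (e (x, τ))‖ ≤ C / (1 + x) ^ 2 * k * |s - 0| := by
      refine intervalIntegral.norm_integral_le_of_norm_le_const fun τ hτ => ?_
      rw [uIoc_of_le hs.1] at hτ
      exact (a' (x, τ)).le_of_opNorm_le_of_le (hb' (x, τ) hx) (hek τ ⟨hτ.1.le, hτ.2.trans hs.2⟩)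
    rw [sub_zero, abs_of_nonneg hs.1] at h2
    have h3 : C / (1 + x) ^ 2 * k * s ≤ C / (1 + x) ^ 2 * k * T := by
      gcongr
      exact hs.2
    refine (norm_sub_le _ _).trans ?_
    have h4 : C * (1 + T) / (1 + x) ^ 2 * k =
      C / (1 + x) ^ 2 * k + C / (1 + x) ^ 2 * k * T := by ring
    simp only at h1
    linarith
  have hrep : ∀ x s : ℝ, 0 ≤ x → s ∈ Icc 0 T →
      ∫ ζ in Ioi x, D (ζ - x) (G (ζ, s)) = -e (x, s) := fun x s hx hs => by
    have hDc : Continuous fun ζ => D (ζ - x) := hD.continuous.comp (continuous_sub_right x)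
    -- `D (ζ - x) e` has derivative `D (ζ - x) G`, since the `Λ` terms cancel, and vanishes at
    -- infinity. Continuity at the left endpoint admits `x = 0`, although derivatives are known only
    -- for `ζ > 0`.
    have := integral_Ioi_of_hasDerivAt_of_tendsto (f := fun ζ => D (ζ - x) (e (ζ, s)))
      (f' := fun ζ => D (ζ - x) (G (ζ, s))) (a := x) (m := 0)
      (hDc.clm_apply (hec.comp (Continuous.prodMk_left s))).continuousWithinAt ?_ ?_ ?_
    · simpa [hD.zero] using this
    · intro ζ hζ
      have h1 : HasDerivAt (fun ζ => D (ζ - x)) (-(Λ * D (ζ - x))) ζ :=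
        (hD.hasDerivAt (ζ - x)).comp_sub_const ζ x
      refine (h1.clm_apply (hed ζ s (hx.trans_lt hζ) hs)).congr_deriv ?_
      rw [hD.comm]
      simp
    · refine integrableOn_Ioi_of_le_div (C := C * (1 + T) * M) (by positivity) hx
        (hDc.clm_apply (hG.comp (Continuous.prodMk_left s))).continuousOn fun ζ hζ => ?_
      have hζ0 : 0 ≤ ζ := hx.trans (le_of_lt hζ)
      have h1 := hGb ζ s M hζ0 hs hM fun τ hτ => (heb ζ τ hζ0 hτ).trans
        (div_le_self hM (by linarith))
      have h2 := (D (ζ - x)).le_of_opNorm_le (hD.norm_le _ (sub_nonneg.2 (le_of_lt hζ))) (G (ζ, s))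
      rw [one_mul] at h2
      exact h2.trans (h1.trans (le_of_eq (by ring)))
    · refine squeeze_zero_norm' ?_ (tendsto_div_one_add_atTop M)
      filter_upwards [eventually_ge_atTop x] with ζ hζ
      have h2 := (D (ζ - x)).le_of_opNorm_le (hD.norm_le _ (sub_nonneg.2 hζ)) (e (ζ, s))
      rw [one_mul] at h2
      exact h2.trans (heb ζ s (hx.trans hζ) hs)
  have hCT : 0 ≤ C * (1 + T) := by positivity
  -- In the constant `C (1 + T)`, `C` comes from `a e` and `C T` from the time integral of `a' e`.
  -- The weight depends on `z` alone, so the nonlocality in time is harmless.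
  have key := eq_zero_of_halving (g := e) (φ := fun p => weight (C * (1 + T)) p.1)
    (S := Ici 0 ×ˢ Icc 0 T) hM (fun p hp => by
      have h1 := one_le_weight hCT hp.1
      have h2 := (heb p.1 p.2 hp.1 hp.2).trans (div_le_self hM (by linarith [mem_Ici.1 hp.1]))
      exact h2.trans (by nlinarith)) (fun k hk hs p hp => by
      rw [← norm_neg, ← hrep p.1 p.2 hp.1 hp.2]
      refine norm_integral_Ioi_le_half_weight hCT hk hp.1 fun ζ hζ => ?_
      have hζ0 : 0 ≤ ζ := le_trans (mem_Ici.1 hp.1) (le_of_lt hζ)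
      have h2 := (D (ζ - p.1)).le_of_opNorm_le (hD.norm_le _ (sub_nonneg.2 (le_of_lt hζ)))
        (G (ζ, p.2))
      rw [one_mul] at h2
      exact h2.trans (hGb ζ p.2 _ hζ0 hp.2 (by unfold weight; positivity)
        fun τ hτ => hs (ζ, τ) ⟨hζ0, hτ⟩))
  have := key (z, t) ⟨hz, ht⟩
  exact sub_eq_zero.1 this

end Evolution

/-! ## Linear differential equations on a compact interval -/

/-- Solutions of linear differential equations exist on the whole interval. -/
theorem exists_linear_ode_solution {E : Type*} [NormedAddCommGroup E] [NormedSpace ℝ E]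
    [CompleteSpace E] {Q : ℝ → E →L[ℝ] E} (hQ : Continuous Q) {T : ℝ} (hT : 0 ≤ T) (x₀ : E) :
    ∃ x : ℝ → E, Continuous x ∧ ∀ t ∈ Icc 0 T, x t = x₀ + ∫ τ in (0 : ℝ)..t, Q τ (x τ) := by
  obtain ⟨C, hC⟩ := (isCompact_Icc (a := (0 : ℝ)) (b := T)).exists_bound_of_continuousOn
    hQ.continuousOn
  have hC0 : 0 ≤ C := (norm_nonneg _).trans (hC 0 ⟨le_rfl, hT⟩)
  -- Freezing the upper limit outside `[0, T]` keeps the fixed point problem in bounded functions on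
  -- `ℝ`.
  let c : ℝ → ℝ := fun t => max 0 (min t T)
  have hc : Continuous c := by fun_prop
  have hc0 : ∀ t, 0 ≤ c t := fun t => le_max_left _ _
  have hcT : ∀ t, c t ≤ T := fun t => max_le hT (min_le_right _ _)
  have hcc : ∀ t ∈ Icc 0 T, c t = t := fun t ht => by simp [c, ht.1, ht.2]
  have hcont : ∀ h : BoundedContinuousFunction ℝ E, Continuous fun τ => Q τ (h τ) :=
    fun h => hQ.clm_apply h.continuous
  let f : BoundedContinuousFunction ℝ E → BoundedContinuousFunction ℝ E := fun h =>
    BoundedContinuousFunction.ofNormedAddCommGroup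
      (fun t => x₀ + ∫ τ in (0 : ℝ)..c t, Q τ (h τ))
      (continuous_const.add ((intervalIntegral.continuous_primitive
        (fun a b => (hcont h).intervalIntegrable a b) 0).comp hc))
      (‖x₀‖ + C * ‖h‖ * T) fun t => by
        refine (norm_add_le _ _).trans ?_
        gcongr
        refine (intervalIntegral.norm_integral_le_of_norm_le_const (C := C * ‖h‖)
          fun τ hτ => ?_).trans ?_
        · rw [uIoc_of_le (hc0 t)] at hτ
          exact (Q τ).le_of_opNorm_le_of_le (hC τ ⟨hτ.1.le, hτ.2.trans (hcT t)⟩)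
            (h.norm_coe_le_norm τ)
        · rw [sub_zero, abs_of_nonneg (hc0 t)]
          gcongr
          exact hcT t
  obtain ⟨h, hh⟩ := exists_fixedPoint_of_halving f (φ := fun t => Real.exp (2 * C * c t))
    (M := Real.exp (2 * C * T))
    (fun t => Real.one_le_exp (mul_nonneg (by positivity) (hc0 t)))
    (fun t => Real.exp_le_exp.2 (mul_le_mul_of_nonneg_left (hcT t) (by positivity)))
    (fun g h K hK hgh t => by
      have e1 : f g t - f h t = ∫ τ in (0 : ℝ)..c t, Q τ (g τ - h τ) := by
        simp only [map_sub]
        rw [intervalIntegral.integral_sub ((hcont g).intervalIntegrable _ _)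
          ((hcont h).intervalIntegrable _ _)]
        simp [f]
      have hd : ∀ τ : ℝ, HasDerivAt (fun τ => K / 2 * Real.exp (2 * C * τ))
          (C * (K * Real.exp (2 * C * τ))) τ := fun τ => by
        have := (((hasDerivAt_id τ).const_mul (2 * C)).exp.const_mul (K / 2))
        exact this.congr_deriv (by simp; ring)
      have hi : ∫ τ in (0 : ℝ)..c t, C * (K * Real.exp (2 * C * τ)) =
          K / 2 * Real.exp (2 * C * c t) - K / 2 * Real.exp (2 * C * 0) :=
        intervalIntegral.integral_eq_sub_of_hasDerivAt (fun τ _ => hd τ)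
          (Continuous.intervalIntegrable (by fun_prop) _ _)
      rw [e1]
      refine (intervalIntegral.norm_integral_le_of_norm_le (hc0 t)
        (g := fun τ => C * (K * Real.exp (2 * C * τ)))
        (Eventually.of_forall fun τ hτ => ?_)
        (Continuous.intervalIntegrable (by fun_prop) _ _)).trans ?_
      · have hτ' : τ ∈ Icc 0 T := ⟨hτ.1.le, hτ.2.trans (hcT t)⟩
        have := hgh τ
        rw [hcc τ hτ'] at this
        exact (Q τ).le_of_opNorm_le_of_le (hC τ hτ') this
      · rw [hi]
        have : 0 ≤ K / 2 * Real.exp (2 * C * 0) := by positivity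
        linarith)
  refine ⟨h, h.continuous, fun t ht => ?_⟩
  have := DFunLike.congr_fun hh t
  rw [← this]
  change x₀ + _ = x₀ + _
  rw [hcc t ht]

/-! ## Two by two systems -/

/-- The real-linear operator on `ℂ²` given by a matrix. -/
noncomputable def matCLM (M : Matrix (Fin 2) (Fin 2) ℂ) : (Fin 2 → ℂ) →L[ℝ] (Fin 2 → ℂ) :=
  LinearMap.toContinuousLinearMap (M.mulVecLin.restrictScalars ℝ)

@[simp]
theorem matCLM_apply (M : Matrix (Fin 2) (Fin 2) ℂ) (x : Fin 2 → ℂ) : matCLM M x = M *ᵥ x := rfl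

theorem matCLM_mul (M N : Matrix (Fin 2) (Fin 2) ℂ) : matCLM (M * N) = matCLM M * matCLM N := by
  ext1 x
  exact (mulVec_mulVec x M N).symm

theorem matCLM_add (M N : Matrix (Fin 2) (Fin 2) ℂ) : matCLM (M + N) = matCLM M + matCLM N := by
  ext1 x
  simp [add_mulVec]

theorem matCLM_sub (M N : Matrix (Fin 2) (Fin 2) ℂ) : matCLM (M - N) = matCLM M - matCLM N := by
  ext1 x
  simp [sub_mulVec]

theorem matCLM_neg (M : Matrix (Fin 2) (Fin 2) ℂ) : matCLM (-M) = -matCLM M := by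
  ext1 x
  simp [neg_mulVec]

theorem matCLM_one : matCLM 1 = 1 := by
  ext1 x
  simp

/-- Reduces continuity and differentiability of operator-valued maps to the four scalar entries. -/
theorem matCLM_eq_sum (M : Matrix (Fin 2) (Fin 2) ℂ) :
    matCLM M = M 0 0 • matCLM !![1, 0; 0, 0] + M 0 1 • matCLM !![0, 1; 0, 0] +
      M 1 0 • matCLM !![0, 0; 1, 0] + M 1 1 • matCLM !![0, 0; 0, 1] := by
  ext x i
  fin_cases i <;> simp [mulVec, dotProduct, Fin.sum_univ_two]

theorem continuous_matCLM {X : Type*} [TopologicalSpace X] {M : X → Matrix (Fin 2) (Fin 2) ℂ}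
    (hM : ∀ i j, Continuous fun x => M x i j) : Continuous fun x => matCLM (M x) := by
  simp only [fun x => matCLM_eq_sum (M x)]
  have h1 := hM 0 0
  have h2 := hM 0 1
  have h3 := hM 1 0
  have h4 := hM 1 1
  fun_prop

theorem hasDerivAt_matCLM {M : ℝ → Matrix (Fin 2) (Fin 2) ℂ} {M' : Matrix (Fin 2) (Fin 2) ℂ}
    {x : ℝ} (hM : ∀ i j, HasDerivAt (fun x => M x i j) (M' i j) x) :
    HasDerivAt (fun x => matCLM (M x)) (matCLM M') x := by
  simp only [fun x => matCLM_eq_sum (M x), matCLM_eq_sum M']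
  have h : ∀ i j (N : Matrix (Fin 2) (Fin 2) ℂ),
      HasDerivAt (fun x => M x i j • matCLM N) (M' i j • matCLM N) x :=
    fun i j N => (hM i j).smul_const (matCLM N)
  exact (((h 0 0 _).add (h 0 1 _)).add (h 1 0 _)).add (h 1 1 _)

theorem norm_matCLM_le {M : Matrix (Fin 2) (Fin 2) ℂ} {K : ℝ} (hM : ∀ i j, ‖M i j‖ ≤ K) :
    ‖matCLM M‖ ≤ 2 * K := by
  have hK : 0 ≤ K := (norm_nonneg _).trans (hM 0 0)
  refine ContinuousLinearMap.opNorm_le_bound _ (by positivity) fun x => ?_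
  rw [pi_norm_le_iff_of_nonneg (by positivity)]
  intro i
  rw [matCLM_apply, mulVec, dotProduct, Fin.sum_univ_two]
  refine (norm_add_le _ _).trans ?_
  rw [norm_mul, norm_mul]
  have h0 := mul_le_mul (hM i 0) (norm_le_pi_norm x 0) (norm_nonneg _) hK
  have h1 := mul_le_mul (hM i 1) (norm_le_pi_norm x 1) (norm_nonneg _) hK
  linarith

/-- The Wronskian of two solutions of a trace-free system is constant. -/
theorem wronskian_eq {T : ℝ} {Q : ℝ → Matrix (Fin 2) (Fin 2) ℂ} (htr : ∀ t, Q t 1 1 = -Q t 0 0)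
    {x y : ℝ → Fin 2 → ℂ} (hx : ContinuousOn x (Icc 0 T)) (hy : ContinuousOn y (Icc 0 T))
    (hdx : ∀ t ∈ Ioo 0 T, HasDerivAt x (Q t *ᵥ x t) t)
    (hdy : ∀ t ∈ Ioo 0 T, HasDerivAt y (Q t *ᵥ y t) t) {t : ℝ} (ht : t ∈ Icc 0 T) :
    x t 0 * y t 1 - x t 1 * y t 0 = x 0 0 * y 0 1 - x 0 1 * y 0 0 := by
  rw [continuousOn_pi] at hx hy
  have h := intervalIntegral.integral_eq_sub_of_hasDerivAt_of_le
    (f := fun t => x t 0 * y t 1 - x t 1 * y t 0) (f' := fun _ => 0) ht.1 ?_ ?_ ?_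
  · rw [intervalIntegral.integral_zero] at h
    exact (sub_eq_zero.1 h.symm)
  · exact ((((hx 0).mul (hy 1)).sub ((hx 1).mul (hy 0)))).mono (Icc_subset_Icc_right ht.2)
  · intro s hs
    have hs' : s ∈ Ioo 0 T := ⟨hs.1, hs.2.trans_le ht.2⟩
    have h1 := hasDerivAt_pi.1 (hdx s hs')
    have h2 := hasDerivAt_pi.1 (hdy s hs')
    refine (((h1 0).mul (h2 1)).sub ((h1 1).mul (h2 0))).congr_deriv ?_
    simp only [mulVec, dotProduct, Fin.sum_univ_two, htr s]
    ring
  · exact intervalIntegrable_const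

open ComplexConjugate

/-! ## Calculus on the half-strip -/

/-- The retraction of the plane onto the half-strip. -/
noncomputable def clamp (T : ℝ) (p : ℝ × ℝ) : ℝ × ℝ := (max p.1 0, max 0 (min p.2 T))

theorem continuous_clamp (T : ℝ) : Continuous (clamp T) := by
  unfold clamp
  fun_prop

variable {T : ℝ}

theorem clamp_mem (hT : 0 ≤ T) (p : ℝ × ℝ) : clamp T p ∈ strip T :=
  ⟨mem_Ici.2 (le_max_right p.1 0), mem_Icc.2 ⟨le_max_left _ _, max_le hT (min_le_right _ _)⟩⟩

theorem clamp_eq {z t : ℝ} (hz : 0 ≤ z) (ht : t ∈ Icc 0 T) : clamp T (z, t) = (z, t) := by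
  simp [clamp, hz, ht.1, ht.2]

/-- Supplies the globally continuous coefficients required by the abstract Volterra and evolution
lemmas; on the strip nothing changes. -/
theorem continuous_comp_clamp {X : Type*} [TopologicalSpace X] (hT : 0 ≤ T) {f : ℝ × ℝ → X}
    (hf : ContinuousOn f (strip T)) : Continuous fun p => f (clamp T p) :=
  hf.comp_continuous (continuous_clamp T) (clamp_mem hT)

theorem uniqueDiffOn_strip (hT : 0 < T) : UniqueDiffOn ℝ (strip T) :=
  (uniqueDiffOn_Ici 0).prod (uniqueDiffOn_Icc hT)

theorem hasDerivWithinAt_fst {f : ℝ × ℝ → ℂ} (hf : DifferentiableOn ℝ f (strip T)) {p : ℝ × ℝ}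
    (hp : p ∈ strip T) : HasDerivWithinAt (fun x => f (x, p.2))
      (fderivWithin ℝ f (strip T) p (1, 0)) (Ici 0) p.1 :=
  (hf p hp).hasFDerivWithinAt.comp_hasDerivWithinAt (f := fun x => (x, p.2)) p.1
    ((hasDerivWithinAt_id _ _).prodMk (hasDerivWithinAt_const _ _ _)) fun _ hx => ⟨hx, hp.2⟩

theorem hasDerivWithinAt_snd {f : ℝ × ℝ → ℂ} (hf : DifferentiableOn ℝ f (strip T)) {p : ℝ × ℝ}
    (hp : p ∈ strip T) : HasDerivWithinAt (fun x => f (p.1, x))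
      (fderivWithin ℝ f (strip T) p (0, 1)) (Icc 0 T) p.2 :=
  (hf p hp).hasFDerivWithinAt.comp_hasDerivWithinAt (f := fun x => (p.1, x)) p.2
    ((hasDerivWithinAt_const _ _ _).prodMk (hasDerivWithinAt_id _ _)) fun _ hx => ⟨hp.1, hx⟩

/-- Identifies the one-sided partial derivative with a component of the Fréchet derivative within
the strip, through which smoothness and decay are inherited. -/
theorem dz_eq {f : ℝ × ℝ → ℂ} (hf : DifferentiableOn ℝ f (strip T)) {p : ℝ × ℝ}
    (hp : p ∈ strip T) : dz f p = fderivWithin ℝ f (strip T) p (1, 0) :=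
  (hasDerivWithinAt_fst hf hp).derivWithin (uniqueDiffOn_Ici 0 _ hp.1)

theorem hasDerivAt_dz {f : ℝ × ℝ → ℂ} (hf : DifferentiableOn ℝ f (strip T)) {z t : ℝ}
    (hz : 0 < z) (ht : t ∈ Icc 0 T) : HasDerivAt (fun x => f (x, t)) (dz f (z, t)) z := by
  have hp : (z, t) ∈ strip T := ⟨hz.le, ht⟩
  rw [dz_eq hf hp]
  exact (hasDerivWithinAt_fst hf hp).hasDerivAt (Ici_mem_nhds hz)

theorem hasDerivAt_dt {f : ℝ × ℝ → ℂ} (hf : DifferentiableOn ℝ f (strip T)) {z t : ℝ}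
    (hz : 0 ≤ z) (ht : t ∈ Ioo 0 T) : HasDerivAt (fun x => f (z, x)) (dt f (z, t)) t := by
  have hp : (z, t) ∈ strip T := ⟨hz, Ioo_subset_Icc_self ht⟩
  exact ((hasDerivWithinAt_snd hf hp).hasDerivAt
    (Icc_mem_nhds ht.1 ht.2)).differentiableAt.hasDerivAt

theorem contDiffOn_dz (hT : 0 < T) {f : ℝ × ℝ → ℂ} (hf : ContDiffOn ℝ ∞ f (strip T)) :
    ContDiffOn ℝ ∞ (dz f) (strip T) :=
  ((hf.fderivWithin (uniqueDiffOn_strip hT) (m := ∞) (by simp)).clm_apply contDiffOn_const).congr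
    fun _ hp => dz_eq (hf.differentiableOn (by simp)) hp

/-! ### Decaying functions as an ideal among bounded ones -/

/-- Continuous functions on the half-strip that are of size `(1 + z)⁻²`. -/
def Decays (T : ℝ) (f : ℝ × ℝ → ℂ) : Prop :=
  ContinuousOn f (strip T) ∧ ∃ C, ∀ p ∈ strip T, ‖f p‖ ≤ C / (1 + p.1) ^ 2

/-- Bounded continuous functions on the half-strip. -/
def Bounds (T : ℝ) (f : ℝ × ℝ → ℂ) : Prop :=
  ContinuousOn f (strip T) ∧ ∃ C, ∀ p ∈ strip T, ‖f p‖ ≤ C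

theorem Decays.bounds {f : ℝ × ℝ → ℂ} (hf : Decays T f) : Bounds T f := by
  obtain ⟨h, C, hC⟩ := hf
  refine ⟨h, max C 0, fun p hp => (hC p hp).trans ?_⟩
  have h1 : 0 ≤ p.1 := hp.1
  rw [div_le_iff₀ (by positivity)]
  nlinarith [le_max_left C 0, le_max_right C 0, mul_nonneg (le_max_right C 0) h1,
    mul_nonneg (mul_nonneg (le_max_right C 0) h1) h1]

theorem Decays.add {f g : ℝ × ℝ → ℂ} (hf : Decays T f) (hg : Decays T g) :
    Decays T fun p => f p + g p := by
  obtain ⟨h, C, hC⟩ := hf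
  obtain ⟨h', C', hC'⟩ := hg
  refine ⟨h.add h', C + C', fun p hp => (norm_add_le _ _).trans ?_⟩
  rw [add_div]
  exact add_le_add (hC p hp) (hC' p hp)

theorem Decays.mul {f g : ℝ × ℝ → ℂ} (hf : Decays T f) (hg : Bounds T g) :
    Decays T fun p => f p * g p := by
  obtain ⟨h, C, hC⟩ := hf
  obtain ⟨h', C', hC'⟩ := hg
  refine ⟨h.mul h', C * C', fun p hp => ?_⟩
  rw [norm_mul, mul_div_right_comm]
  exact mul_le_mul (hC p hp) (hC' p hp) (norm_nonneg _) ((norm_nonneg _).trans (hC p hp))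

theorem bounds_const (c : ℂ) : Bounds T fun _ => c := ⟨continuousOn_const, ‖c‖, fun _ _ => le_rfl⟩

theorem Decays.const_mul {f : ℝ × ℝ → ℂ} (hf : Decays T f) (c : ℂ) :
    Decays T fun p => c * f p := by
  simpa only [mul_comm] using hf.mul (bounds_const c)

theorem Decays.conj {f : ℝ × ℝ → ℂ} (hf : Decays T f) : Decays T fun p => conj (f p) := by
  obtain ⟨h, C, hC⟩ := hf
  exact ⟨Complex.continuous_conj.comp_continuousOn h, C, fun p hp => by simpa using hC p hp⟩

theorem Decays.congr {f g : ℝ × ℝ → ℂ} (hf : Decays T f) (h : ∀ p, g p = f p) : Decays T g := by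
  rwa [funext h]

variable {r : ℝ × ℝ → ℂ}

theorem IsSchwartz.differentiableOn (hr : IsSchwartz T r) : DifferentiableOn ℝ r (strip T) :=
  hr.smooth.differentiableOn (by simp)

theorem IsSchwartz.differentiableOn_dz (hT : 0 < T) (hr : IsSchwartz T r) :
    DifferentiableOn ℝ (dz r) (strip T) :=
  (contDiffOn_dz hT hr.smooth).differentiableOn (by simp)

/-- Only quadratic decay is needed: the moments `k = 0` and `k = 2` suffice because `(1 + z)² ≤ 2 (1
+ z²)`. -/
theorem IsSchwartz.decays_aux (hr : IsSchwartz T r) {f : ℝ × ℝ → ℂ}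
    (hf : ContinuousOn f (strip T)) (n : ℕ)
    (h : ∀ p ∈ strip T, ‖f p‖ ≤ ‖iteratedFDerivWithin ℝ n r (strip T) p‖) : Decays T f := by
  obtain ⟨C₀, h₀⟩ := hr.decay 0 n
  obtain ⟨C₂, h₂⟩ := hr.decay 2 n
  refine ⟨hf, 2 * (C₀ + C₂), fun p hp => (h p hp).trans ?_⟩
  have h1 : 0 ≤ p.1 := hp.1
  have h3 := h₀ p hp
  have h4 := h₂ p hp
  rw [le_div_iff₀ (by positivity)]
  rw [pow_zero, one_mul] at h3
  rw [sq_abs] at h4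
  nlinarith [mul_nonneg (norm_nonneg (iteratedFDerivWithin ℝ n r (strip T) p))
    (sq_nonneg (p.1 - 1))]

theorem IsSchwartz.decays (hr : IsSchwartz T r) : Decays T r :=
  hr.decays_aux hr.smooth.continuousOn 0 fun p _ => by simp

theorem norm_clm_basis_le {F : Type*} [NormedAddCommGroup F] [NormedSpace ℝ F]
    (φ : ℝ × ℝ →L[ℝ] F) : ‖φ (1, 0)‖ ≤ ‖φ‖ := by
  have := φ.le_opNorm (1, 0)
  simpa [Prod.norm_def] using this

theorem IsSchwartz.decays_dz (hT : 0 < T) (hr : IsSchwartz T r) : Decays T (dz r) :=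
  hr.decays_aux (contDiffOn_dz hT hr.smooth).continuousOn 1 fun p hp => by
    rw [dz_eq hr.differentiableOn hp, ← norm_iteratedFDerivWithin_fderivWithin
      (uniqueDiffOn_strip hT) hp, norm_iteratedFDerivWithin_zero]
    exact norm_clm_basis_le _

theorem IsSchwartz.decays_dz_dz (hT : 0 < T) (hr : IsSchwartz T r) : Decays T (dz (dz r)) :=
  hr.decays_aux (contDiffOn_dz hT (contDiffOn_dz hT hr.smooth)).continuousOn 2 fun p hp => by
    have hu := uniqueDiffOn_strip hT
    have hd : DifferentiableOn ℝ (fderivWithin ℝ r (strip T)) (strip T) :=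
      (hr.smooth.fderivWithin hu (m := ∞) (by simp)).differentiableOn (by simp)
    rw [dz_eq (hr.differentiableOn_dz hT) hp,
      fderivWithin_congr (fun q hq => dz_eq hr.differentiableOn hq) (dz_eq hr.differentiableOn hp),
      fderivWithin_clm_apply (hu p hp) (hd p hp) (differentiableWithinAt_const _)]
    have h1 := norm_clm_basis_le (fderivWithin ℝ (fderivWithin ℝ r (strip T)) (strip T) p)
    have h2 := norm_clm_basis_le (fderivWithin ℝ (fderivWithin ℝ r (strip T)) (strip T) p (1, 0))
    rw [← norm_iteratedFDerivWithin_fderivWithin hu hp, ← norm_iteratedFDerivWithin_fderivWithin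
      hu hp, norm_iteratedFDerivWithin_zero]
    simpa using h2.trans h1

/-! ## The phase `θ` -/

theorem Theta1_eq (r : ℝ × ℝ → ℂ) (p : ℝ × ℝ) : Theta1 r p = r p * conj (r p) / 4 := by
  rw [Theta1, Complex.mul_conj']

theorem Theta2_eq (r : ℝ × ℝ → ℂ) (p : ℝ × ℝ) : Theta2 r p =
    (r p * conj (r p)) ^ 2 / 8 + Complex.I / 4 * (conj (r p) * dz r p - r p * conj (dz r p)) := by
  rw [Theta2, Complex.mul_conj']
  ring

theorem conj_Theta1 (r : ℝ × ℝ → ℂ) (p : ℝ × ℝ) : conj (Theta1 r p) = Theta1 r p := by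
  simp [Theta1_eq, map_ofNat]
  ring

theorem conj_Theta2 (r : ℝ × ℝ → ℂ) (p : ℝ × ℝ) : conj (Theta2 r p) = Theta2 r p := by
  simp [Theta2_eq, map_ofNat]
  ring

/-- Since `Θ` is real, the gauge factors have modulus one and the gauge transformation preserves all
decay. -/
theorem conj_theta (r : ℝ × ℝ → ℂ) (p : ℝ × ℝ) : conj (theta r p) = theta r p := by
  simp only [theta, map_add, intervalIntegral, map_sub, ← integral_conj, conj_Theta1, conj_Theta2]

theorem norm_exp_theta (r : ℝ × ℝ → ℂ) (p : ℝ × ℝ) (c : ℝ) :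
    ‖Complex.exp (c * Complex.I * theta r p)‖ = 1 := by
  obtain ⟨x, hx⟩ := Complex.conj_eq_iff_real.1 (conj_theta r p)
  rw [hx, mul_right_comm, ← Complex.ofReal_mul, Complex.norm_exp_ofReal_mul_I]

theorem decays_Theta1 (hr : IsSchwartz T r) : Decays T (Theta1 r) :=
  ((hr.decays.mul hr.decays.conj.bounds).const_mul (1 / 4)).congr fun p => by
    rw [Theta1_eq]
    ring

theorem decays_Theta2 (hT : 0 < T) (hr : IsSchwartz T r) : Decays T (Theta2 r) := by
  have h := hr.decays.mul hr.decays.conj.bounds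
  have h' := hr.decays_dz hT
  refine (((h.mul h.bounds).const_mul (1 / 8)).add (((h'.mul hr.decays.conj.bounds).const_mul
    (Complex.I / 4)).add ((hr.decays.mul h'.conj.bounds).const_mul (-Complex.I / 4)))).congr
    fun p => ?_
  rw [Theta2_eq]
  ring

theorem theta_eq_clamp {z t : ℝ} (hz : 0 ≤ z) (ht : t ∈ Icc 0 T) : theta r (z, t) =
    (∫ τ in (0 : ℝ)..t, Theta2 r (clamp T (0, τ))) +
      ∫ ζ in (0 : ℝ)..z, Theta1 r (clamp T (ζ, t)) := by
  unfold theta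
  congr 1
  · refine intervalIntegral.integral_congr fun τ hτ => ?_
    rw [uIcc_of_le ht.1] at hτ
    rw [clamp_eq le_rfl ⟨hτ.1, hτ.2.trans ht.2⟩]
  · refine intervalIntegral.integral_congr fun ζ hζ => ?_
    rw [uIcc_of_le hz] at hζ
    rw [clamp_eq hζ.1 ht]

theorem continuousOn_theta (hT : 0 < T) (hr : IsSchwartz T r) :
    ContinuousOn (theta r) (strip T) := by
  have h1 := continuous_comp_clamp hT.le (decays_Theta1 hr).1
  have h2 := continuous_comp_clamp hT.le (decays_Theta2 hT hr).1
  have h : Continuous fun p : ℝ × ℝ => (∫ τ in (0 : ℝ)..p.2, Theta2 r (clamp T (0, τ))) +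
      ∫ ζ in (0 : ℝ)..p.1, Theta1 r (clamp T (ζ, p.2)) := by
    refine Continuous.add ?_ ?_
    · refine intervalIntegral.continuous_parametric_intervalIntegral_of_continuous ?_ continuous_snd
      exact h2.comp (by fun_prop : Continuous fun q : (ℝ × ℝ) × ℝ => ((0 : ℝ), q.2))
    · refine intervalIntegral.continuous_parametric_intervalIntegral_of_continuous ?_ continuous_fst
      exact h1.comp (by fun_prop : Continuous fun q : (ℝ × ℝ) × ℝ => (q.2, q.1.2))
  exact h.continuousOn.congr fun p hp => theta_eq_clamp hp.1 hp.2

theorem bounds_exp_theta (hT : 0 < T) (hr : IsSchwartz T r) (c : ℝ) :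
    Bounds T fun p => Complex.exp (c * Complex.I * theta r p) :=
  ⟨(continuousOn_const.mul (continuousOn_theta hT hr)).cexp, 1,
    fun p _ => (norm_exp_theta r p c).le⟩

theorem hasDerivAt_theta_fst (hT : 0 < T) (hr : IsSchwartz T r) {z t : ℝ} (hz : 0 < z)
    (ht : t ∈ Icc 0 T) : HasDerivAt (fun x => theta r (x, t)) (Theta1 r (z, t)) z := by
  have hc : Continuous fun x => Theta1 r (clamp T (x, t)) :=
    (continuous_comp_clamp hT.le (decays_Theta1 hr).1).comp (Continuous.prodMk_left t)
  have h := (intervalIntegral.integral_hasDerivAt_right (hc.intervalIntegrable 0 z)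
    (hc.stronglyMeasurableAtFilter _ _) hc.continuousAt).const_add
    (∫ τ in (0 : ℝ)..t, Theta2 r (clamp T (0, τ)))
  rw [clamp_eq hz.le ht] at h
  exact h.congr_of_eventuallyEq ((eventually_gt_nhds hz).mono fun x hx => theta_eq_clamp hx.le ht)

/-- The time derivative of a solution, as given by the equation. -/
noncomputable def flow (r : ℝ × ℝ → ℂ) (p : ℝ × ℝ) : ℂ :=
  Complex.I * dz (dz r) p + Complex.I * (r p * conj (r p)) * r p + r p * conj (r p) * dz r p

/-- Multiplying the equation by `-i` isolates `r_t`. The expression `flow` is continuous up to the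
boundary of the strip, whereas `dt` is a two-sided derivative and is meaningful only for interior
times. -/
theorem hasDerivAt_flow (hr : IsSchwartz T r) (hsol : IsSolution T r) {z t : ℝ} (hz : 0 < z)
    (ht : t ∈ Ioo 0 T) : HasDerivAt (fun s => r (z, s)) (flow r (z, t)) t := by
  refine (hasDerivAt_dt hr.differentiableOn hz.le ht).congr_deriv ?_
  have h := hsol z t hz ht.1 ht.2
  rw [flow, Complex.mul_conj']
  linear_combination (-Complex.I) * h +
    (dt r (z, t) - ‖r (z, t)‖ ^ 2 * dz r (z, t)) * Complex.I_sq

theorem decays_flow (hT : 0 < T) (hr : IsSchwartz T r) : Decays T (flow r) := by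
  have h := hr.decays.mul hr.decays.conj.bounds
  refine (((hr.decays_dz_dz hT).const_mul Complex.I).add
    (((h.const_mul Complex.I).mul hr.decays.bounds).add (h.mul (hr.decays_dz hT).bounds))).congr
    fun p => ?_
  rw [flow]
  ring

/-- The form `Θ` is closed. -/
theorem theta_eq_add_integral (hT : 0 < T) (hr : IsSchwartz T r) (hsol : IsSolution T r) {z t : ℝ}
    (hz : 0 ≤ z) (ht : t ∈ Icc 0 T) : theta r (z, t) =
      theta r (z, 0) + ∫ τ in (0 : ℝ)..t, Theta2 r (clamp T (z, τ)) := by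
  have ht0 : (0 : ℝ) ∈ Icc 0 T := ⟨le_rfl, hT.le⟩
  have hc1 := continuous_comp_clamp hT.le (decays_Theta1 hr).1
  have hc2 := continuous_comp_clamp hT.le (decays_Theta2 hT hr).1
  -- `g` is the common value of `∂_t Θ₁` and `∂_z Θ₂`; their equality is the local conservation law
  -- of the equation.
  let g : ℝ × ℝ → ℂ := fun p => (flow r p * conj (r p) + r p * conj (flow r p)) / 4
  have hg : Continuous fun p => g (clamp T p) := by
    refine continuous_comp_clamp hT.le (ContinuousOn.div_const ?_ _)
    exact (((decays_flow hT hr).mul hr.decays.conj.bounds).add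
      (hr.decays.mul (decays_flow hT hr).conj.bounds)).1
  have hd1 : ∀ x s : ℝ, 0 < x → s ∈ Ioo 0 T →
      HasDerivAt (fun s => Theta1 r (clamp T (x, s))) (g (clamp T (x, s))) s := by
    intro x s hx hs
    have h := hasDerivAt_flow hr hsol hx hs
    rw [clamp_eq hx.le (Ioo_subset_Icc_self hs)]
    have h' := ((h.mul h.star).div_const 4)
    refine h'.congr_of_eventuallyEq (eventually_of_mem (Ioo_mem_nhds hs.1 hs.2) fun y hy => ?_)
    simp only
    rw [clamp_eq hx.le (Ioo_subset_Icc_self hy), Theta1_eq]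
    rfl
  have hd2 : ∀ x s : ℝ, 0 < x → s ∈ Ioo 0 T →
      HasDerivAt (fun x => Theta2 r (clamp T (x, s))) (g (clamp T (x, s))) x := by
    intro x s hx hs
    have hs' := Ioo_subset_Icc_self hs
    have h := hasDerivAt_dz hr.differentiableOn hx hs'
    have h' := hasDerivAt_dz (hr.differentiableOn_dz hT) hx hs'
    rw [clamp_eq hx.le hs']
    have h2 := (((h.mul h.star).pow 2).div_const 8).add
      (((h.star.mul h').sub (h.mul h'.star)).const_mul (Complex.I / 4))
    refine (h2.congr_of_eventuallyEq ((eventually_gt_nhds hx).mono fun y hy => ?_)).congr_deriv ?_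
    · rw [clamp_eq (le_of_lt hy) hs', Theta2_eq]
      rfl
    · simp [g, flow]
      ring
  -- The defect between the two paths from `(0,0)` to `(x,t)`. It vanishes at `x = 0`, has zero
  -- derivative for `x > 0` and is continuous up to `0`.
  let Φ : ℝ → ℂ := fun x => theta r (x, t) - (theta r (x, 0) +
    ∫ τ in (0 : ℝ)..t, Theta2 r (clamp T (x, τ)))
  have hline : ∀ s ∈ Icc 0 T, ContinuousOn (fun x => theta r (x, s)) (Icc 0 z) := fun s hs =>
    (continuousOn_theta hT hr).comp (Continuous.continuousOn (by fun_prop))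
      fun x hx => ⟨hx.1, hs⟩
  have hΦ := intervalIntegral.integral_eq_sub_of_hasDerivAt_of_le (f := Φ) (f' := fun _ => 0) hz
    ?_ ?_ intervalIntegrable_const
  · rw [intervalIntegral.integral_zero] at hΦ
    have h0 : Φ 0 = 0 := by
      simp only [Φ]
      rw [theta_eq_clamp le_rfl ht, theta_eq_clamp le_rfl ht0]
      simp
    rw [h0, sub_zero] at hΦ
    exact sub_eq_zero.1 hΦ.symm
  · refine (hline t ht).sub ((hline 0 ht0).add (Continuous.continuousOn ?_))
    exact intervalIntegral.continuous_parametric_intervalIntegral_of_continuous' hc2 _ _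
  · intro x hx
    have h1 := hasDerivAt_intervalIntegral_param (T := T) hc2 hg hx.1 ht hd2
    refine ((hasDerivAt_theta_fst hT hr hx.1 ht).sub
      ((hasDerivAt_theta_fst hT hr hx.1 ht0).add h1)).congr_deriv ?_
    have h2 := intervalIntegral.integral_eq_sub_of_hasDerivAt_of_le
      (f := fun s => Theta1 r (clamp T (x, s))) (f' := fun s => g (clamp T (x, s))) ht.1
      (hc1.comp (Continuous.prodMk_right x)).continuousOn
      (fun s hs => hd1 x s hx.1 ⟨hs.1, hs.2.trans_le ht.2⟩)
      ((hg.comp (Continuous.prodMk_right x)).intervalIntegrable _ _)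
    rw [h2, clamp_eq hx.1.le ht, clamp_eq hx.1.le ht0]
    ring

theorem hasDerivAt_theta_snd (hT : 0 < T) (hr : IsSchwartz T r) (hsol : IsSolution T r) {z t : ℝ}
    (hz : 0 ≤ z) (ht : t ∈ Ioo 0 T) :
    HasDerivAt (fun s => theta r (z, s)) (Theta2 r (z, t)) t := by
  have hc : Continuous fun s => Theta2 r (clamp T (z, s)) :=
    (continuous_comp_clamp hT.le (decays_Theta2 hT hr).1).comp (Continuous.prodMk_right z)
  have h := (intervalIntegral.integral_hasDerivAt_right (hc.intervalIntegrable 0 t)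
    (hc.stronglyMeasurableAtFilter _ _) hc.continuousAt).const_add (theta r (z, 0))
  rw [clamp_eq hz (Ioo_subset_Icc_self ht)] at h
  exact h.congr_of_eventuallyEq (eventually_of_mem (Ioo_mem_nhds ht.1 ht.2) fun s hs =>
    theta_eq_add_integral hT hr hsol hz (Ioo_subset_Icc_self hs))

/-! ## The gauge-transformed Lax pair -/

theorem expSigmaHat_eq (x : ℂ) (M : Matrix (Fin 2) (Fin 2) ℂ) : expSigmaHat x M =
    !![M 0 0, Complex.exp (2 * x) * M 0 1; Complex.exp (-(2 * x)) * M 1 0, M 1 1] := by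
  have h1 : Complex.exp x * Complex.exp (-x) = 1 := by rw [← Complex.exp_add]; simp
  have h2 : Complex.exp (2 * x) = Complex.exp x * Complex.exp x := by
    rw [← Complex.exp_add]; ring_nf
  have h3 : Complex.exp (-(2 * x)) = Complex.exp (-x) * Complex.exp (-x) := by
    rw [← Complex.exp_add]; ring_nf
  ext i j
  fin_cases i <;> fin_cases j <;>
    simp only [expSigmaHat, expSigma, Matrix.mul_apply, Fin.sum_univ_two] <;> simp [h2, h3]
  · linear_combination M 0 0 * h1
  · ring
  · ring
  · linear_combination M 1 1 * h1

theorem expSigmaHatCol_eq (x : ℂ) (m : Fin 2 → ℂ) :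
    expSigmaHatCol x m = !![Complex.exp (2 * x), 0; 0, 1] *ᵥ m := by
  have h1 : Complex.exp x * Complex.exp (-x) = 1 := by rw [← Complex.exp_add]; simp
  have h2 : Complex.exp (2 * x) = Complex.exp x * Complex.exp x := by
    rw [← Complex.exp_add]; ring_nf
  ext i
  fin_cases i <;> simp [expSigmaHatCol, expSigma, mulVec, dotProduct, Fin.sum_univ_two, h2]
  · ring
  · linear_combination m 1 * h1

/-- The phase factor `e^{icθ}`. -/
noncomputable def phase (c : ℝ) (r : ℝ × ℝ → ℂ) (p : ℝ × ℝ) : ℂ :=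
  Complex.exp (c * Complex.I * theta r p)

theorem phase_mul_phase (r : ℝ × ℝ → ℂ) (p : ℝ × ℝ) : phase (-2) r p * phase 2 r p = 1 := by
  rw [phase, phase, ← Complex.exp_add]
  simp

/-- As `R² = -|r|²`, the diagonal terms of `A` and `-iΘ₁σ` add up; only the off-diagonal entries see
the phase. -/
theorem A1_eq (r : ℝ × ℝ → ℂ) (p : ℝ × ℝ) (s : ℂ) : A1 r p s =
    !![-(Complex.I / 2) * (r p * conj (r p)), s * r p * phase (-2) r p;
      -s * conj (r p) * phase 2 r p, Complex.I / 2 * (r p * conj (r p))] := by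
  have e1 : 2 * -(Complex.I * theta r p) = (-2 : ℝ) * Complex.I * theta r p := by push_cast; ring
  have e2 : -(2 * -(Complex.I * theta r p)) = (2 : ℝ) * Complex.I * theta r p := by push_cast; ring
  rw [A1, expSigmaHat_eq, e2, e1]
  ext i j
  fin_cases i <;> fin_cases j <;>
    simp [A, R, sigma, Theta1_eq, pow_succ, phase]
  all_goals ring

/-- The upper right entry of `B`, without the factor `ς`. -/
noncomputable def Bupper (r : ℝ × ℝ → ℂ) (s : ℂ) (p : ℝ × ℝ) : ℂ :=
  (1 - 2 * s ^ 2) * r p + Complex.I * dz r p + 1 / 2 * (r p * conj (r p)) * r p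

/-- The lower left entry of `B`, without the factor `ς`. -/
noncomputable def Blower (r : ℝ × ℝ → ℂ) (s : ℂ) (p : ℝ × ℝ) : ℂ :=
  (2 * s ^ 2 - 1) * conj (r p) + Complex.I * conj (dz r p) - 1 / 2 * (r p * conj (r p)) * conj (r p)

/-- The diagonal entry of `B - iΘ₂σ`. -/
noncomputable def Bdiag (r : ℝ × ℝ → ℂ) (s : ℂ) (p : ℝ × ℝ) : ℂ :=
  Complex.I * s ^ 2 * (r p * conj (r p)) - Complex.I / 4 * (r p * conj (r p)) ^ 2 +
    1 / 2 * (conj (r p) * dz r p - r p * conj (dz r p))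

theorem B1_eq (r : ℝ × ℝ → ℂ) (p : ℝ × ℝ) (s : ℂ) : B1 r p s =
    !![Bdiag r s p, s * Bupper r s p * phase (-2) r p;
      s * Blower r s p * phase 2 r p, -Bdiag r s p] := by
  have e1 : 2 * -(Complex.I * theta r p) = (-2 : ℝ) * Complex.I * theta r p := by push_cast; ring
  have e2 : -(2 * -(Complex.I * theta r p)) = (2 : ℝ) * Complex.I * theta r p := by push_cast; ring
  rw [B1, expSigmaHat_eq, e2, e1]
  ext i j
  fin_cases i <;> fin_cases j <;>
    simp [B, R, Rz, sigma, Theta2_eq, pow_succ, phase, Bdiag,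
      Bupper, Blower]
  · linear_combination (-(1 / 4) * (conj (r p) * dz r p - r p * conj (dz r p))) * Complex.I_sq
  · ring
  · ring
  · linear_combination ((1 / 4) * (conj (r p) * dz r p - r p * conj (dz r p))) * Complex.I_sq

/-- The time derivative of `A₁`. -/
noncomputable def A1t (r : ℝ × ℝ → ℂ) (p : ℝ × ℝ) (s : ℂ) : Matrix (Fin 2) (Fin 2) ℂ :=
  !![-(Complex.I / 2) * (flow r p * conj (r p) + r p * conj (flow r p)),
      s * (flow r p - 2 * Complex.I * Theta2 r p * r p) * phase (-2) r p;
    -s * (conj (flow r p) + 2 * Complex.I * Theta2 r p * conj (r p)) * phase 2 r p,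
      Complex.I / 2 * (flow r p * conj (r p) + r p * conj (flow r p))]

/-- The generator of the free evolution in `z` of the second column. -/
noncomputable def genX (s : ℂ) : Matrix (Fin 2) (Fin 2) ℂ := !![2 * Complex.I * lam s, 0; 0, 0]

/-- The generator of the free evolution in `t` of the second column. -/
noncomputable def genT (s : ℂ) : Matrix (Fin 2) (Fin 2) ℂ :=
  !![-(4 * Complex.I * lam s ^ 2), 0; 0, 0]

theorem hasDerivAt_phase_fst (hT : 0 < T) (hr : IsSchwartz T r) (c : ℝ) {z t : ℝ} (hz : 0 < z)
    (ht : t ∈ Icc 0 T) : HasDerivAt (fun x => phase c r (x, t))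
      (phase c r (z, t) * (c * Complex.I * Theta1 r (z, t))) z :=
  ((hasDerivAt_theta_fst hT hr hz ht).const_mul (c * Complex.I)).cexp

theorem hasDerivAt_phase_snd (hT : 0 < T) (hr : IsSchwartz T r) (hsol : IsSolution T r) (c : ℝ)
    {z t : ℝ} (hz : 0 ≤ z) (ht : t ∈ Ioo 0 T) : HasDerivAt (fun x => phase c r (z, x))
      (phase c r (z, t) * (c * Complex.I * Theta2 r (z, t))) t :=
  ((hasDerivAt_theta_snd hT hr hsol hz ht).const_mul (c * Complex.I)).cexp

/-- Time enters through `r`, where the equation supplies `flow`, and through the phase, where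
closedness of `Θ` supplies `Θ₂`. -/
theorem hasDerivAt_A1 (hT : 0 < T) (hr : IsSchwartz T r) (hsol : IsSolution T r) (s : ℂ) {z t : ℝ}
    (hz : 0 < z) (ht : t ∈ Ioo 0 T) (i j : Fin 2) :
    HasDerivAt (fun x => A1 r (z, x) s i j) (A1t r (z, t) s i j) t := by
  have h : HasDerivAt (fun x => r (z, x)) (flow r (z, t)) t := hasDerivAt_flow hr hsol hz ht
  have h' : HasDerivAt (fun x => conj (r (z, x))) (conj (flow r (z, t))) t := h.star
  have hm := hasDerivAt_phase_snd hT hr hsol (-2) hz.le ht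
  have hp := hasDerivAt_phase_snd hT hr hsol 2 hz.le ht
  simp only [A1_eq, A1t]
  fin_cases i <;> fin_cases j
  · exact (h.mul h').const_mul _
  · refine ((h.const_mul s).mul hm).congr_deriv ?_
    simp
    ring
  · refine ((h'.const_mul (-s)).mul hp).congr_deriv ?_
    simp
    ring
  · exact (h.mul h').const_mul _

/-- The zero curvature equation for the gauge-transformed Lax pair. -/
theorem hasDerivAt_B1 (hT : 0 < T) (hr : IsSchwartz T r) (s : ℂ) {z t : ℝ}
    (hz : 0 < z) (ht : t ∈ Icc 0 T) (i j : Fin 2) :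
    HasDerivAt (fun x => (genT s + B1 r (x, t) s) i j)
      ((A1t r (z, t) s + (genX s + A1 r (z, t) s) * (genT s + B1 r (z, t) s) -
        (genT s + B1 r (z, t) s) * (genX s + A1 r (z, t) s)) i j) z := by
  have h : HasDerivAt (fun x => r (x, t)) (dz r (z, t)) z :=
    hasDerivAt_dz hr.differentiableOn hz ht
  have h' : HasDerivAt (fun x => conj (r (x, t))) (conj (dz r (z, t))) z := h.star
  have k : HasDerivAt (fun x => dz r (x, t)) (dz (dz r) (z, t)) z :=
    hasDerivAt_dz (hr.differentiableOn_dz hT) hz ht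
  have k' : HasDerivAt (fun x => conj (dz r (x, t))) (conj (dz (dz r) (z, t))) z := k.star
  have hm := hasDerivAt_phase_fst hT hr (-2) hz ht
  have hp := hasDerivAt_phase_fst hT hr 2 hz ht
  have hq := h.mul h'
  have hd : HasDerivAt (fun x => Bdiag r s (x, t)) _ z :=
    ((hq.const_mul (Complex.I * s ^ 2)).sub ((hq.pow 2).const_mul (Complex.I / 4))).add
      (((h'.mul k).sub (h.mul k')).const_mul (1 / 2))
  have hu : HasDerivAt (fun x => Bupper r s (x, t)) _ z :=
    ((h.const_mul (1 - 2 * s ^ 2)).add (k.const_mul Complex.I)).add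
      ((hq.const_mul (1 / 2)).mul h)
  have hl : HasDerivAt (fun x => Blower r s (x, t)) _ z :=
    ((h'.const_mul (2 * s ^ 2 - 1)).add (k'.const_mul Complex.I)).sub
      ((hq.const_mul (1 / 2)).mul h')
  have hpp := phase_mul_phase r (z, t)
  -- With `r_t` replaced by `flow` inside `A1t`, each entry is a polynomial identity in `r`, `r_z`,
  -- `r_zz`, their conjugates and the phases, modulo `I² = -1` and the phases being mutually
  -- inverse.
  simp only [A1_eq, B1_eq, A1t, genX, genT]
  fin_cases i <;> fin_cases j
  · refine (hd.const_add _).congr_deriv ?_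
    simp [Bdiag, Bupper, Blower, flow]
    linear_combination (1 / 2 * (dz (dz r) (z, t) * conj (r (z, t)) - r (z, t) * conj (dz (dz r) (z, t)))) *
      Complex.I_sq - (s ^ 2 * Complex.I * (dz r (z, t) * conj (r (z, t)) + r (z, t) * conj (dz r (z, t)))) * hpp
  · refine (((hu.const_mul s).mul hm).const_add 0).congr_deriv ?_
    simp [Bdiag, Bupper, Blower, flow, Theta1_eq, Theta2_eq, lam]
    linear_combination (s * phase (-2) r (z, t) * ((conj (r (z, t)) * dz r (z, t) - r (z, t) * conj (dz r (z, t)))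
      * r (z, t) / 2 - (2 * s ^ 2 - 1) * dz r (z, t) + (r (z, t) * conj (r (z, t))) * dz r (z, t) / 2)) *
      Complex.I_sq
  · refine (((hl.const_mul s).mul hp).const_add 0).congr_deriv ?_
    simp [Bdiag, Bupper, Blower, flow, Theta1_eq, Theta2_eq, lam]
    linear_combination (s * phase 2 r (z, t) * ((conj (r (z, t)) * dz r (z, t) - r (z, t) * conj (dz r (z, t)))
      * conj (r (z, t)) / 2 + (2 * s ^ 2 - 1) * conj (dz r (z, t)) -
      (r (z, t) * conj (r (z, t))) * conj (dz r (z, t)) / 2)) * Complex.I_sq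
  · refine (hd.neg.const_add 0).congr_deriv ?_
    simp [Bdiag, Bupper, Blower, flow]
    linear_combination (-(1 / 2 * (dz (dz r) (z, t) * conj (r (z, t)) - r (z, t) * conj (dz (dz r) (z, t))))) *
      Complex.I_sq + (s ^ 2 * Complex.I * (dz r (z, t) * conj (r (z, t)) + r (z, t) * conj (dz r (z, t)))) * hpp

theorem decays_A1 (hT : 0 < T) (hr : IsSchwartz T r) (s : ℂ) (i j : Fin 2) :
    Decays T fun p => A1 r p s i j := by
  have h := hr.decays.mul hr.decays.conj.bounds
  simp only [A1_eq]
  fin_cases i <;> fin_cases j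
  · exact h.const_mul _
  · exact (hr.decays.const_mul s).mul (bounds_exp_theta hT hr (-2))
  · exact (hr.decays.conj.const_mul (-s)).mul (bounds_exp_theta hT hr 2)
  · exact h.const_mul _

theorem decays_A1t (hT : 0 < T) (hr : IsSchwartz T r) (s : ℂ) (i j : Fin 2) :
    Decays T fun p => A1t r p s i j := by
  have hf := decays_flow hT hr
  have h := (hf.mul hr.decays.conj.bounds).add (hr.decays.mul hf.conj.bounds)
  have h2 := decays_Theta2 hT hr
  simp only [A1t]
  fin_cases i <;> fin_cases j
  · exact h.const_mul _
  · refine (((hf.add ((h2.const_mul (-(2 * Complex.I))).mul hr.decays.bounds)).const_mul s).mul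
      (bounds_exp_theta hT hr (-2))).congr fun p => ?_
    change s * (flow r p - 2 * Complex.I * Theta2 r p * r p) * phase (-2) r p = _
    unfold phase
    ring
  · exact ((hf.conj.add ((h2.const_mul (2 * Complex.I)).mul hr.decays.conj.bounds)).const_mul
      (-s)).mul (bounds_exp_theta hT hr 2)
  · exact h.const_mul _

theorem decays_B1 (hT : 0 < T) (hr : IsSchwartz T r) (s : ℂ) (i j : Fin 2) :
    Decays T fun p => B1 r p s i j := by
  have h := hr.decays
  have h' := hr.decays_dz hT
  have hq := h.mul h.conj.bounds
  have hd : Decays T (Bdiag r s) := by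
    refine (((hq.const_mul (Complex.I * s ^ 2)).add ((hq.mul hq.bounds).const_mul
      (-(Complex.I / 4)))).add (((h'.mul h.conj.bounds).const_mul (1 / 2)).add
        ((h.mul h'.conj.bounds).const_mul (-(1 / 2))))).congr fun p => ?_
    rw [Bdiag]
    ring
  have hu : Decays T (Bupper r s) := by
    refine (((h.const_mul (1 - 2 * s ^ 2)).add (h'.const_mul Complex.I)).add
      ((hq.mul h.bounds).const_mul (1 / 2))).congr fun p => ?_
    rw [Bupper]
    ring
  have hl : Decays T (Blower r s) := by
    refine (((h.conj.const_mul (2 * s ^ 2 - 1)).add (h'.conj.const_mul Complex.I)).add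
      ((hq.mul h.conj.bounds).const_mul (-(1 / 2)))).congr fun p => ?_
    rw [Blower]
    ring
  simp only [B1_eq]
  fin_cases i <;> fin_cases j
  · exact hd
  · exact (hu.const_mul s).mul (bounds_exp_theta hT hr (-2))
  · exact (hl.const_mul s).mul (bounds_exp_theta hT hr 2)
  · exact (hd.const_mul (-1)).congr fun p => by simp

theorem continuous_matCLM_clamp (hT : 0 < T) {M : ℝ × ℝ → Matrix (Fin 2) (Fin 2) ℂ}
    (hM : ∀ i j, Decays T fun p => M p i j) : Continuous fun p => matCLM (M (clamp T p)) :=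
  continuous_matCLM fun i j => continuous_comp_clamp hT.le (hM i j).1

theorem exists_norm_matCLM_clamp_le (hT : 0 < T) {M : ℝ × ℝ → Matrix (Fin 2) (Fin 2) ℂ}
    (hM : ∀ i j, Decays T fun p => M p i j) : ∃ C, 0 ≤ C ∧
      ∀ p : ℝ × ℝ, 0 ≤ p.1 → ‖matCLM (M (clamp T p))‖ ≤ C / (1 + p.1) ^ 2 := by
  choose hc C hC using hM
  refine ⟨2 * ∑ i, ∑ j, |C i j|, by positivity, fun p hp => ?_⟩
  rw [mul_div_assoc]
  refine norm_matCLM_le fun i j => (hC i j _ (clamp_mem hT.le p)).trans ?_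
  have h1 : (clamp T p).1 = p.1 := max_eq_left hp
  rw [h1]
  gcongr
  calc C i j ≤ |C i j| := le_abs_self _
    _ ≤ ∑ j, |C i j| := Finset.single_le_sum (f := fun j => |C i j|)
        (fun _ _ => abs_nonneg _) (Finset.mem_univ j)
    _ ≤ ∑ i, ∑ j, |C i j| := Finset.single_le_sum (f := fun i => ∑ j, |C i j|)
        (fun _ _ => Finset.sum_nonneg fun _ _ => abs_nonneg _) (Finset.mem_univ i)

/-! ## The eigenfunction normalised at infinity -/

/-- The free propagator `e^{-iλxσ̂}` on second columns. -/
noncomputable def propagator (s : ℂ) (x : ℝ) : (Fin 2 → ℂ) →L[ℝ] (Fin 2 → ℂ) :=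
  matCLM !![Complex.exp (-(2 * Complex.I * lam s) * x), 0; 0, 1]

theorem isContractionGroup_propagator {s : ℂ} (hs : (s ^ 2).im ≤ 0) :
    IsContractionGroup (propagator s) (matCLM (genX s)) ![0, 1] where
  norm_le x hx := by
    refine ContinuousLinearMap.opNorm_le_bound _ zero_le_one fun v => ?_
    rw [one_mul, pi_norm_le_iff_of_nonneg (norm_nonneg _)]
    have he : ‖Complex.exp (-(2 * Complex.I * lam s) * x)‖ ≤ 1 := by
      rw [Complex.norm_exp, Real.exp_le_one_iff]
      have : (-(2 * Complex.I * lam s) * x).re = 2 * (s ^ 2).im * x := by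
        simp [lam]
      rw [this]
      nlinarith
    have h0 : propagator s x v 0 = Complex.exp (-(2 * Complex.I * lam s) * x) * v 0 := by
      simp [propagator, vecHead]
    have h1 : propagator s x v 1 = v 1 := by
      simp [propagator, vecHead, vecTail]
    refine Fin.forall_fin_two.2 ⟨?_, ?_⟩
    · rw [h0, norm_mul]
      exact (mul_le_of_le_one_left (norm_nonneg _) he).trans (norm_le_pi_norm v 0)
    · rw [h1]
      exact norm_le_pi_norm v 1
  zero := by
    rw [propagator, ← matCLM_one]
    congr 1
    ext i j
    fin_cases i <;> fin_cases j <;> simp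
  add x y := by
    rw [propagator, propagator, propagator, ← matCLM_mul]
    congr 1
    ext i j
    fin_cases i <;> fin_cases j <;> simp [← Complex.exp_add]
    ring_nf
  hasDerivAt x := by
    have h : -(matCLM (genX s) * propagator s x) =
        matCLM (-(genX s * !![Complex.exp (-(2 * Complex.I * lam s) * x), 0; 0, 1])) := by
      rw [matCLM_neg, matCLM_mul, propagator]
    rw [h]
    refine hasDerivAt_matCLM fun i j => ?_
    fin_cases i <;> fin_cases j
    · have h1 : HasDerivAt (fun x : ℝ => -(2 * Complex.I * lam s) * (x : ℂ))
          (-(2 * Complex.I * lam s) * 1) x :=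
        (Complex.ofRealCLM.hasDerivAt (x := x)).const_mul _
      refine h1.cexp.congr_deriv ?_
      simp [genX]
      ring
    · simpa [genX] using hasDerivAt_const x (0 : ℂ)
    · simpa [genX] using hasDerivAt_const x (0 : ℂ)
    · simpa [genX] using hasDerivAt_const x (1 : ℂ)
  comm x := by
    rw [propagator, ← matCLM_mul, ← matCLM_mul]
    congr 1
    ext i j
    fin_cases i <;> fin_cases j <;> simp [genX]
    ring
  map_eq_zero := by
    ext i
    fin_cases i <;> simp [genX]

theorem propagator_apply (s : ℂ) (z ζ : ℝ) (m : Fin 2 → ℂ) :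
    propagator s (ζ - z) m = expSigmaHatCol (Complex.I * lam s * ((z - ζ : ℝ) : ℂ)) m := by
  have h : -(2 * Complex.I * lam s) * ((ζ - z : ℝ) : ℂ) =
      2 * (Complex.I * lam s * ((z - ζ : ℝ) : ℂ)) := by
    push_cast
    ring
  rw [expSigmaHatCol_eq, propagator, matCLM_apply, h]

/-- Needed to take components of the vector-valued integral; at `z = 0` it also gives the absolute
convergence of `c⁺`. -/
theorem integrableOn_propagator (hT : 0 < T) (hr : IsSchwartz T r) {s : ℂ}
    (hs : (s ^ 2).im ≤ 0) {t : ℝ} (ht : t ∈ Icc 0 T) {h : ℝ → Fin 2 → ℂ}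
    (hc : ContinuousOn h (Ici 0)) (hb : ∃ C, ∀ z ∈ Ici (0 : ℝ), ‖h z‖ ≤ C) {z : ℝ}
    (hz : z ∈ Ici (0 : ℝ)) : IntegrableOn (fun ζ =>
      expSigmaHatCol (Complex.I * lam s * ((z - ζ : ℝ) : ℂ)) (A1 r (ζ, t) s *ᵥ h ζ)) (Ioi z) := by
  have hD := isContractionGroup_propagator hs
  obtain ⟨C, hC, hCb⟩ := exists_norm_matCLM_clamp_le hT (decays_A1 hT hr s)
  have hac := continuous_matCLM_clamp hT (decays_A1 hT hr s)
  obtain ⟨K, hK⟩ := hb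
  have hK0 : 0 ≤ K := (norm_nonneg _).trans (hK z hz)
  have hi : IntegrableOn (fun ζ => propagator s (ζ - z)
      (matCLM (A1 r (clamp T (ζ, t)) s) (h ζ))) (Ioi z) := by
    refine integrableOn_Ioi_of_le_div (C := C * K) (by positivity) hz ?_ fun ζ hζ => ?_
    · refine ContinuousOn.clm_apply (Continuous.continuousOn ?_) (ContinuousOn.clm_apply
        (Continuous.continuousOn (hac.comp (Continuous.prodMk_left t))) (hc.mono ?_))
      · exact hD.continuous.comp (continuous_sub_right z)
      · exact fun x hx => le_trans (mem_Ici.1 hz) (le_of_lt hx)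
    · have hζ0 : 0 ≤ ζ := le_trans (mem_Ici.1 hz) (le_of_lt hζ)
      exact (norm_clm_comp_apply_le (hD.norm_le _ (sub_nonneg.2 (le_of_lt hζ)))
        (hCb (ζ, t) hζ0) (hK _ hζ0)).trans (le_of_eq (by ring))
  refine hi.congr_fun (fun ζ hζ => ?_) measurableSet_Ioi
  simp only
  rw [propagator_apply, matCLM_apply, clamp_eq (le_trans (mem_Ici.1 hz) (le_of_lt hζ)) ht]

/-- The integral equation for `[H₃]₂` as a vector-valued Volterra equation. -/
theorem isH3_iff (hT : 0 < T) (hr : IsSchwartz T r) {s : ℂ} (hs : (s ^ 2).im ≤ 0) {t : ℝ}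
    (ht : t ∈ Icc 0 T) {h : ℝ → Fin 2 → ℂ} : IsH3 r t s h ↔
      ContinuousOn h (Ici 0) ∧ (∃ C, ∀ z ∈ Ici (0 : ℝ), ‖h z‖ ≤ C) ∧
      ∀ z ∈ Ici (0 : ℝ), h z = ![0, 1] - ∫ ζ in Ioi z,
        propagator s (ζ - z) (matCLM (A1 r (clamp T (ζ, t)) s) (h ζ)) := by
  have key : ContinuousOn h (Ici 0) → (∃ C, ∀ z ∈ Ici (0 : ℝ), ‖h z‖ ≤ C) →
      ∀ z ∈ Ici (0 : ℝ), ∀ i, (∫ ζ in Ioi z, propagator s (ζ - z)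
        (matCLM (A1 r (clamp T (ζ, t)) s) (h ζ))) i = ∫ ζ in Ioi z,
          expSigmaHatCol (Complex.I * lam s * ((z - ζ : ℝ) : ℂ)) (A1 r (ζ, t) s *ᵥ h ζ) i := by
    intro hc hb z hz i
    rw [← eval_integral fun i => (integrableOn_propagator hT hr hs ht hc hb hz).eval i]
    refine congrFun (setIntegral_congr_fun measurableSet_Ioi fun ζ hζ => ?_) i
    rw [propagator_apply, matCLM_apply, clamp_eq (le_trans (mem_Ici.1 hz) (le_of_lt hζ)) ht]
  have hv : ∀ i, (1 : Matrix (Fin 2) (Fin 2) ℂ) i 1 = (![0, 1] : Fin 2 → ℂ) i := by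
    exact Fin.forall_fin_two.2 ⟨by simp, by simp⟩
  constructor
  · intro H
    refine ⟨H.continuousOn, H.bounded, fun z hz => ?_⟩
    ext i
    rw [H.eq z hz i, Pi.sub_apply, key H.continuousOn H.bounded z hz i, hv]
  · rintro ⟨h1, h2, h3⟩
    refine ⟨h1, h2, fun z hz i => ?_⟩
    rw [← key h1 h2 z hz i, hv]
    exact congrFun (h3 z hz) i

/-- The eigenfunction normalised at infinity: existence for all times simultaneously, and its
evolution in time at `z = 0`. -/
theorem exists_isH3 (hT : 0 < T) (hr : IsSchwartz T r) (hsol : IsSolution T r) {s : ℂ}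
    (hs : (s ^ 2).im ≤ 0) : ∃ h : ℝ × ℝ → Fin 2 → ℂ, Continuous h ∧
      (∀ t ∈ Icc 0 T, IsH3 r t s fun z => h (z, t)) ∧
      ∀ t ∈ Ioo 0 T, HasDerivAt (fun t => h (0, t)) ((genT s + B1 r (0, t) s) *ᵥ h (0, t)) t := by
  have hD := isContractionGroup_propagator hs
  obtain ⟨C₁, hC₁, hb₁⟩ := exists_norm_matCLM_clamp_le hT (decays_A1 hT hr s)
  obtain ⟨C₂, hC₂, hb₂⟩ := exists_norm_matCLM_clamp_le hT (decays_A1t hT hr s)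
  obtain ⟨C₃, hC₃, hb₃⟩ := exists_norm_matCLM_clamp_le hT (decays_B1 hT hr s)
  have ha := continuous_matCLM_clamp hT (decays_A1 hT hr s)
  have ha' := continuous_matCLM_clamp hT (decays_A1t hT hr s)
  have hB := continuous_matCLM_clamp hT (decays_B1 hT hr s)
  have hY : Continuous fun p => matCLM (genT s + B1 r (clamp T p) s) := by
    simp only [matCLM_add]
    exact continuous_const.add hB
  obtain ⟨h, hh, ⟨K, hK⟩, he⟩ := exists_volterra_solution hD.continuous hD.norm_le ha hC₁ hb₁ ![0, 1]
  refine ⟨h, hh, fun t ht => (isH3_iff hT hr hs ht).2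
    ⟨by fun_prop, ⟨K, fun z _ => hK _⟩, fun z hz => he z t hz⟩, fun t ht => ?_⟩
  have hle : ∀ {c : ℝ} {x : ℝ}, c ≤ C₁ + C₂ + C₃ → 0 ≤ x →
      c / (1 + x) ^ 2 ≤ (C₁ + C₂ + C₃) / (1 + x) ^ 2 := fun hc hx => by gcongr
  -- Here `Y = genT + B₁`. Its limit `genT` annihilates `(0,1)ᵀ`, and `B₁` decays like `(1+z)⁻²`,
  -- faster than `evolution` requires.
  have hev : ∀ t ∈ Icc 0 T, _ := fun t ht => hD.evolution (T := T) ha ha' hY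
    (C := C₁ + C₂ + C₃) (by positivity)
    (fun p hp => (hb₁ p hp).trans (hle (by linarith) hp))
    (fun p hp => (hb₂ p hp).trans (hle (by linarith) hp))
    (N := matCLM (genT s)) (by ext i; fin_cases i <;> simp [genT])
    (fun p hp => by
      rw [matCLM_add, add_sub_cancel_left]
      refine ((hb₃ p hp).trans (hle (by linarith) hp)).trans ?_
      gcongr
      nlinarith)
    (fun z t hz ht => by
      rw [clamp_eq hz.le (Ioo_subset_Icc_self ht)]
      refine (hasDerivAt_matCLM (hasDerivAt_A1 hT hr hsol s hz ht)).congr_of_eventuallyEq ?_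
      filter_upwards [Ioo_mem_nhds ht.1 ht.2] with τ hτ
      rw [clamp_eq hz.le (Ioo_subset_Icc_self hτ)])
    (fun z t hz ht => by
      have ht' := Ioo_subset_Icc_self ht
      rw [clamp_eq hz.le ht', ← matCLM_add, ← matCLM_mul, ← matCLM_mul, ← matCLM_add,
        ← matCLM_sub]
      refine (hasDerivAt_matCLM (hasDerivAt_B1 hT hr s hz ht')).congr_of_eventuallyEq ?_
      filter_upwards [eventually_gt_nhds hz] with x hx
      rw [clamp_eq (le_of_lt hx) ht'])
    hh hK he (le_refl (0 : ℝ)) ht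
  have hc : Continuous fun τ => matCLM (genT s + B1 r (clamp T (0, τ)) s) (h (0, τ)) :=
    (hY.clm_apply hh).comp (Continuous.prodMk_right 0)
  have hd := (intervalIntegral.integral_hasDerivAt_right (hc.intervalIntegrable 0 t)
    (hc.stronglyMeasurableAtFilter _ _) hc.continuousAt).const_add (h (0, 0))
  rw [clamp_eq le_rfl (Ioo_subset_Icc_self ht)] at hd
  refine hd.congr_of_eventuallyEq ?_
  filter_upwards [Ioo_mem_nhds ht.1 ht.2] with τ hτ
  exact hev τ (Ioo_subset_Icc_self hτ)

theorem IsH3.eqOn (hT : 0 < T) (hr : IsSchwartz T r) {s : ℂ} (hs : (s ^ 2).im ≤ 0) {t : ℝ}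
    (ht : t ∈ Icc 0 T) {g h : ℝ → Fin 2 → ℂ} (hg : IsH3 r t s g) (hh : IsH3 r t s h) :
    EqOn g h (Ici 0) := by
  have hD := isContractionGroup_propagator hs
  obtain ⟨C, hC, hb⟩ := exists_norm_matCLM_clamp_le hT (decays_A1 hT hr s)
  obtain ⟨g₁, g₂, g₃⟩ := (isH3_iff hT hr hs ht).1 hg
  obtain ⟨h₁, h₂, h₃⟩ := (isH3_iff hT hr hs ht).1 hh
  exact volterra_unique hD.continuous hD.norm_le
    ((continuous_matCLM_clamp hT (decays_A1 hT hr s)).comp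
      (Continuous.prodMk_left t)).continuousOn hC (fun z hz => hb (z, t) hz) _ g₁ h₁ g₂ h₂ g₃ h₃

/-! ## The eigenfunction normalised at the origin -/

/-- The character by which `e^{xσ̂}` acts on a matrix entry. -/
noncomputable def hatChar (i j : Fin 2) (x : ℂ) : ℂ :=
  !![1, Complex.exp (2 * x); Complex.exp (-(2 * x)), 1] i j

theorem expSigmaHat_apply (x : ℂ) (M : Matrix (Fin 2) (Fin 2) ℂ) (i j : Fin 2) :
    expSigmaHat x M i j = hatChar i j x * M i j := by
  rw [expSigmaHat_eq, hatChar]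
  fin_cases i <;> fin_cases j <;> simp

theorem hatChar_add (i j : Fin 2) (x y : ℂ) :
    hatChar i j (x + y) = hatChar i j x * hatChar i j y := by
  simp only [hatChar]
  fin_cases i <;> fin_cases j <;> simp [← Complex.exp_add] <;> ring_nf

theorem continuous_hatChar (i j : Fin 2) : Continuous (hatChar i j) := by
  unfold hatChar
  fin_cases i <;> fin_cases j <;> simp <;> fun_prop

theorem hatChar_mul_one (i j : Fin 2) (x : ℂ) :
    hatChar i j x * (1 : Matrix (Fin 2) (Fin 2) ℂ) i j = (1 : Matrix (Fin 2) (Fin 2) ℂ) i j := by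
  rw [← expSigmaHat_apply, expSigmaHat_eq]
  fin_cases i <;> fin_cases j <;> simp

theorem expSigmaHat_mul (x : ℂ) (M N : Matrix (Fin 2) (Fin 2) ℂ) :
    expSigmaHat x (M * N) = expSigmaHat x M * expSigmaHat x N := by
  have h : expSigma (-x) * expSigma x = 1 := by
    ext i j
    fin_cases i <;> fin_cases j <;> simp [expSigma, ← Complex.exp_add]
  calc expSigma x * (M * N) * expSigma (-x)
      = expSigma x * M * 1 * (N * expSigma (-x)) := by simp only [Matrix.mul_one, Matrix.mul_assoc]
    _ = expSigma x * M * expSigma (-x) * (expSigma x * N * expSigma (-x)) := by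
      rw [← h]; simp only [Matrix.mul_assoc]

theorem expSigmaHat_neg_cancel (x : ℂ) (M : Matrix (Fin 2) (Fin 2) ℂ) :
    expSigmaHat x (expSigmaHat (-x) M) = M := by
  ext i j
  rw [expSigmaHat_apply, expSigmaHat_apply, ← mul_assoc, ← hatChar_add, add_neg_cancel]
  fin_cases i <;> fin_cases j <;> simp [hatChar]

/-- The passage to the interaction picture at time `t`. -/
noncomputable def rot (s : ℂ) (t : ℝ) (M : Matrix (Fin 2) (Fin 2) ℂ) : Matrix (Fin 2) (Fin 2) ℂ :=
  expSigmaHat (2 * Complex.I * lam s ^ 2 * (t : ℂ)) M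

/-- A fundamental solution on `[0, T]` of the `t`-equation on the boundary, in the interaction
picture. -/
structure IsFundamental (T : ℝ) (r : ℝ × ℝ → ℂ) (s : ℂ) (G : ℝ → Matrix (Fin 2) (Fin 2) ℂ) :
    Prop where
  continuousOn : ∀ i j, ContinuousOn (fun t => G t i j) (Icc 0 T)
  zero : G 0 = 1
  hasDerivAt : ∀ t ∈ Ioo 0 T, ∀ i j,
    HasDerivAt (fun t => G t i j) ((rot s t (B1 r (0, t) s) * G t) i j) t

theorem continuousOn_rot_B1 (hT : 0 < T) (hr : IsSchwartz T r) (s : ℂ) (i j : Fin 2) :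
    ContinuousOn (fun t => rot s t (B1 r (0, t) s) i j) (Icc 0 T) := by
  simp only [rot, expSigmaHat_apply]
  refine ((continuous_hatChar i j).comp_continuousOn (Continuous.continuousOn (by fun_prop))).mul ?_
  exact (decays_B1 hT hr s i j).1.comp (Continuous.continuousOn (by fun_prop))
    fun t ht => ⟨self_mem_Ici, ht⟩

/-- Conjugation by `e^{2iλ²tσ̂}` turns the kernel `e^{-2iλ²(t-τ)σ̂}` into `e^{2iλ²τσ̂}`, independent
of `t`. The integral equation becomes a linear differential equation with initial value `I`, on a
compact interval and hence without restriction on `ς`. -/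
theorem isH1_iff (hT : 0 < T) (hr : IsSchwartz T r) (s : ℂ) (H : ℝ → Matrix (Fin 2) (Fin 2) ℂ) :
    IsH1 T r s H ↔ IsFundamental T r s fun t => rot s t (H t) := by
  have hint : ∀ (t : ℝ) (i j : Fin 2),
      hatChar i j (2 * Complex.I * lam s ^ 2 * t) * ∫ τ in (0 : ℝ)..t,
        expSigmaHat (-(2 * Complex.I * lam s ^ 2 * ((t - τ : ℝ) : ℂ))) (B1 r (0, τ) s * H τ) i j =
      ∫ τ in (0 : ℝ)..t, (rot s τ (B1 r (0, τ) s) * rot s τ (H τ)) i j := by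
    intro t i j
    rw [← intervalIntegral.integral_const_mul]
    congr 1
    ext τ
    rw [rot, rot, ← expSigmaHat_mul, expSigmaHat_apply, expSigmaHat_apply, ← mul_assoc,
      ← hatChar_add]
    congr 2
    push_cast
    ring
  have hchar : ∀ (i j : Fin 2) (c : ℂ), Continuous fun t : ℝ => hatChar i j (c * t) :=
    fun i j c => (continuous_hatChar i j).comp (by fun_prop)
  have hne : ∀ (i j : Fin 2) (x : ℂ), hatChar i j x ≠ 0 := by
    intro i j x
    unfold hatChar
    fin_cases i <;> fin_cases j <;> simp
  have hcont : ∀ {G : ℝ → Matrix (Fin 2) (Fin 2) ℂ}, (∀ i j, ContinuousOn (fun t => G t i j)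
      (Icc 0 T)) → ∀ i j, ContinuousOn (fun τ => (rot s τ (B1 r (0, τ) s) * G τ) i j)
      (Icc 0 T) := by
    intro G hG i j
    simp only [Matrix.mul_apply, Fin.sum_univ_two]
    exact ((continuousOn_rot_B1 hT hr s i 0).mul (hG 0 j)).add
      ((continuousOn_rot_B1 hT hr s i 1).mul (hG 1 j))
  constructor
  · intro h
    have hc : ∀ i j, ContinuousOn (fun t => rot s t (H t) i j) (Icc 0 T) := fun i j => by
      simp only [rot, expSigmaHat_apply]
      exact (hchar i j _).continuousOn.mul
        ((continuousOn_pi.1 (continuousOn_pi.1 h.continuousOn i)) j)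
    have he : ∀ t ∈ Icc 0 T, ∀ i j, rot s t (H t) i j = (1 : Matrix (Fin 2) (Fin 2) ℂ) i j +
        ∫ τ in (0 : ℝ)..t, (rot s τ (B1 r (0, τ) s) * rot s τ (H τ)) i j := fun t ht i j => by
      rw [← hint, rot, expSigmaHat_apply, h.eq t ht, mul_add, hatChar_mul_one]
    refine ⟨hc, ?_, fun t ht i j => ?_⟩
    · ext i j
      rw [he 0 ⟨le_rfl, hT.le⟩, intervalIntegral.integral_same, add_zero]
    · have hi := hcont hc i j
      have hd := (intervalIntegral.integral_hasDerivAt_right (a := 0) (b := t)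
        ((hi.mono ?_).intervalIntegrable)
        ((hi.mono Ioo_subset_Icc_self).stronglyMeasurableAtFilter isOpen_Ioo t ht)
        (hi.continuousAt (Icc_mem_nhds ht.1 ht.2))).const_add ((1 : Matrix (Fin 2) (Fin 2) ℂ) i j)
      · refine hd.congr_of_eventuallyEq ?_
        filter_upwards [Ioo_mem_nhds ht.1 ht.2] with τ hτ
        exact he τ (Ioo_subset_Icc_self hτ) i j
      · rw [uIcc_of_le ht.1.le]
        exact Icc_subset_Icc_right ht.2.le
  · intro h
    refine ⟨?_, fun t ht i j => ?_⟩
    · refine continuousOn_pi.2 fun i => continuousOn_pi.2 fun j => ?_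
      have := ((hchar i j (-(2 * Complex.I * lam s ^ 2))).continuousOn (s := Icc 0 T)).mul
        (h.continuousOn i j)
      refine this.congr fun t _ => ?_
      change H t i j = hatChar i j _ * rot s t (H t) i j
      rw [rot, expSigmaHat_apply, ← mul_assoc, ← hatChar_add, neg_mul, neg_add_cancel]
      fin_cases i <;> fin_cases j <;> simp [hatChar]
    · refine mul_left_cancel₀ (hne i j (2 * Complex.I * lam s ^ 2 * t)) ?_
      rw [mul_add, hint, hatChar_mul_one, ← expSigmaHat_apply]
      have hI := intervalIntegral.integral_eq_sub_of_hasDerivAt_of_le ht.1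
        ((h.continuousOn i j).mono (Icc_subset_Icc_right ht.2))
        (fun τ hτ => h.hasDerivAt τ ⟨hτ.1, hτ.2.trans_le ht.2⟩ i j)
        (((hcont h.continuousOn i j).mono ?_).intervalIntegrable)
      · rw [hI, h.zero]
        simp [rot]
      · rw [uIcc_of_le ht.1]
        exact Icc_subset_Icc_right ht.2

theorem exists_isFundamental (hT : 0 < T) (hr : IsSchwartz T r) (s : ℂ) :
    ∃ G, IsFundamental T r s G := by
  let Q : ℝ → Matrix (Fin 2) (Fin 2) ℂ := fun t =>
    rot s (max 0 (min t T)) (B1 r (0, max 0 (min t T)) s)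
  have hQ : Continuous fun t => matCLM (Q t) := continuous_matCLM fun i j =>
    (continuousOn_rot_B1 hT hr s i j).comp_continuous
      (f := fun t : ℝ => max 0 (min t T)) (by fun_prop)
      fun t => ⟨le_max_left _ _, max_le hT.le (min_le_right _ _)⟩
  choose x hxc hx using fun j => exists_linear_ode_solution hQ hT.le
    (fun i => (1 : Matrix (Fin 2) (Fin 2) ℂ) i j)
  refine ⟨fun t i j => x j t i, fun i j => ?_, ?_, fun t ht i j => ?_⟩
  · exact ((continuous_apply i).comp (hxc j)).continuousOn
  · ext i j
    simp [hx j 0 ⟨le_rfl, hT.le⟩]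
  · have hc : Continuous fun t => matCLM (Q t) (x j t) := hQ.clm_apply (hxc j)
    have hd := (intervalIntegral.integral_hasDerivAt_right (hc.intervalIntegrable 0 t)
      (hc.stronglyMeasurableAtFilter _ _) hc.continuousAt).const_add
      (fun i => (1 : Matrix (Fin 2) (Fin 2) ℂ) i j)
    have hd' : HasDerivAt (x j) (matCLM (Q t) (x j t)) t := by
      refine hd.congr_of_eventuallyEq ?_
      filter_upwards [Ioo_mem_nhds ht.1 ht.2] with τ hτ
      exact hx j τ (Ioo_subset_Icc_self hτ)
    have hq : Q t = rot s t (B1 r (0, t) s) := by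
      simp only [Q]
      rw [min_eq_left ht.2.le, max_eq_right ht.1.le]
    refine (hasDerivAt_pi.1 hd' i).congr_deriv ?_
    rw [hq]
    rfl

namespace IsFundamental

variable {s : ℂ} {G : ℝ → Matrix (Fin 2) (Fin 2) ℂ}

theorem col_hasDerivAt (hG : IsFundamental T r s G) (j : Fin 2) {t : ℝ} (ht : t ∈ Ioo 0 T) :
    HasDerivAt (fun t i => G t i j) (rot s t (B1 r (0, t) s) *ᵥ fun i => G t i j) t :=
  hasDerivAt_pi.2 fun i => hG.hasDerivAt t ht i j

theorem rot_B1_trace (s : ℂ) (t : ℝ) :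
    rot s t (B1 r (0, t) s) 1 1 = -rot s t (B1 r (0, t) s) 0 0 := by
  rw [rot, expSigmaHat_eq, B1_eq]
  simp

/-- Liouville's formula: the determinant is the Wronskian of the two columns. -/
theorem det_eq_one (hG : IsFundamental T r s G) {t : ℝ} (ht : t ∈ Icc 0 T) : (G t).det = 1 := by
  have h := wronskian_eq (rot_B1_trace s) (continuousOn_pi.2 fun i => hG.continuousOn i 0)
    (continuousOn_pi.2 fun i => hG.continuousOn i 1) (fun t ht => hG.col_hasDerivAt 0 ht)
    (fun t ht => hG.col_hasDerivAt 1 ht) ht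
  rw [hG.zero] at h
  rw [det_fin_two]
  simp at h
  linear_combination h

/-- Cramer's rule: the Wronskians of `x` with the columns of `G` are constant and equal the
components of `x 0` up to sign; as `det G = 1`, they determine `x t`. Uniqueness of the fundamental
solution follows column by column. -/
theorem eq_mulVec (hG : IsFundamental T r s G) {x : ℝ → Fin 2 → ℂ} (hx : ContinuousOn x (Icc 0 T))
    (hd : ∀ t ∈ Ioo 0 T, HasDerivAt x (rot s t (B1 r (0, t) s) *ᵥ x t) t) {t : ℝ}
    (ht : t ∈ Icc 0 T) : x t = G t *ᵥ x 0 := by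
  have h0 := wronskian_eq (rot_B1_trace s) (continuousOn_pi.2 fun i => hG.continuousOn i 0)
    hx (fun t ht => hG.col_hasDerivAt 0 ht) hd ht
  have h1 := wronskian_eq (rot_B1_trace s) hx (continuousOn_pi.2 fun i => hG.continuousOn i 1)
    hd (fun t ht => hG.col_hasDerivAt 1 ht) ht
  have hdet := hG.det_eq_one ht
  rw [det_fin_two] at hdet
  rw [hG.zero] at h0 h1
  simp at h0 h1
  ext i
  rw [mulVec, dotProduct, Fin.sum_univ_two, ← h0, ← h1]
  fin_cases i
  · simp
    linear_combination (-x t 0) * hdet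
  · simp
    linear_combination (-x t 1) * hdet

theorem eq (hG : IsFundamental T r s G) {G' : ℝ → Matrix (Fin 2) (Fin 2) ℂ}
    (hG' : IsFundamental T r s G') {t : ℝ} (ht : t ∈ Icc 0 T) : G' t = G t := by
  ext i j
  have h := congrFun (hG.eq_mulVec (continuousOn_pi.2 fun i => hG'.continuousOn i j)
    (fun t ht => hG'.col_hasDerivAt j ht) ht) i
  rw [h, hG'.zero]
  simp [mulVec, dotProduct, Matrix.one_apply]

end IsFundamental

/-- `H1` is an arbitrary choice, so existence must be shown first. The witness is a fundamental
solution with the interaction picture undone. -/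
theorem isH1_H1 (hT : 0 < T) (hr : IsSchwartz T r) (s : ℂ) : IsH1 T r s (H1 T r s) := by
  obtain ⟨G, hG⟩ := exists_isFundamental hT hr s
  refine Classical.epsilon_spec (p := IsH1 T r s)
    ⟨fun t => expSigmaHat (-(2 * Complex.I * lam s ^ 2 * (t : ℂ))) (G t), ?_⟩
  rw [isH1_iff hT hr]
  simpa only [rot, expSigmaHat_neg_cancel] using hG

theorem IsH1.eqOn (hT : 0 < T) (hr : IsSchwartz T r) {s : ℂ} {H H' : ℝ → Matrix (Fin 2) (Fin 2) ℂ}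
    (h : IsH1 T r s H) (h' : IsH1 T r s H') : EqOn H H' (Icc 0 T) := fun t ht => by
  have h1 := ((isH1_iff hT hr s H').1 h').eq ((isH1_iff hT hr s H).1 h) ht
  have h2 : ∀ M, expSigmaHat (-(2 * Complex.I * lam s ^ 2 * (t : ℂ))) (rot s t M) = M := fun M => by
    simpa only [rot, neg_neg] using
      expSigmaHat_neg_cancel (-(2 * Complex.I * lam s ^ 2 * (t : ℂ))) M
  rw [← h2 (H t), ← h2 (H' t)]
  exact congrArg _ h1

/-! ## The global relation -/

theorem isFundamental_H1 (hT : 0 < T) (hr : IsSchwartz T r) (s : ℂ) :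
    IsFundamental T r s fun t => rot s t (H1 T r s t) :=
  (isH1_iff hT hr s _).1 (isH1_H1 hT hr s)

theorem det_Winv (hT : 0 < T) (hr : IsSchwartz T r) (s : ℂ) : (Winv T r s).det = 1 :=
  (isFundamental_H1 hT hr s).det_eq_one ⟨hT.le, le_rfl⟩

theorem isH3_H3 (hT : 0 < T) (hr : IsSchwartz T r) (hsol : IsSolution T r) {s : ℂ}
    (hs : (s ^ 2).im ≤ 0) {t : ℝ} (ht : t ∈ Icc 0 T) : IsH3 r t s (H3 r t s) := by
  obtain ⟨h, -, hh, -⟩ := exists_isH3 hT hr hsol hs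
  exact Classical.epsilon_spec (p := IsH3 r t s) ⟨_, hh t ht⟩

/-- `W⁻¹` transports the boundary value of `[H₃]₂` from time `0` to time `T`. -/
theorem Winv_mulVec (hT : 0 < T) (hr : IsSchwartz T r) (hsol : IsSolution T r) {s : ℂ}
    (hs : (s ^ 2).im ≤ 0) : (Winv T r s *ᵥ H3 r 0 s 0) 0 =
      Complex.exp (4 * Complex.I * lam s ^ 2 * T) * H3 r T s 0 0 := by
  obtain ⟨h, hc, hh, hd⟩ := exists_isH3 hT hr hsol hs
  have e : ∀ t ∈ Icc 0 T, H3 r t s 0 = h (0, t) := fun t ht =>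
    (isH3_H3 hT hr hsol hs ht).eqOn hT hr hs ht (hh t ht) self_mem_Ici
  rw [e 0 ⟨le_rfl, hT.le⟩, e T ⟨hT.le, le_rfl⟩]
  -- The interaction picture for a second column: the factor `e^{4iλ²t}` on the upper entry cancels
  -- `genT`, so `k` solves the same system as the columns of the fundamental solution.
  let k : ℝ → Fin 2 → ℂ := fun t =>
    ![Complex.exp (4 * Complex.I * lam s ^ 2 * t) * h (0, t) 0, h (0, t) 1]
  have hh0 : ∀ i, Continuous fun t => h (0, t) i := fun i =>
    (continuous_apply i).comp (hc.comp (Continuous.prodMk_right 0))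
  have hk : ContinuousOn k (Icc 0 T) := by
    refine (continuous_pi (Fin.forall_fin_two.2 ⟨?_, ?_⟩)).continuousOn
    · exact Continuous.mul (by fun_prop) (hh0 0)
    · exact hh0 1
  have hkd : ∀ t ∈ Ioo 0 T, HasDerivAt k (rot s t (B1 r (0, t) s) *ᵥ k t) t := fun t ht => by
    have h1 := hasDerivAt_pi.1 (hd t ht)
    have h2 : HasDerivAt (fun x : ℝ => 4 * Complex.I * lam s ^ 2 * (x : ℂ))
        (4 * Complex.I * lam s ^ 2 * 1) t := (Complex.ofRealCLM.hasDerivAt (x := t)).const_mul _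
    have e1 : Complex.exp (2 * (2 * Complex.I * lam s ^ 2 * t)) =
        Complex.exp (4 * Complex.I * lam s ^ 2 * t) := by ring_nf
    have e2 : Complex.exp (-(2 * (2 * Complex.I * lam s ^ 2 * t))) *
        Complex.exp (4 * Complex.I * lam s ^ 2 * t) = 1 := by
      rw [← Complex.exp_add, ← Complex.exp_zero]
      ring_nf
    rw [rot, expSigmaHat_eq, e1]
    refine hasDerivAt_pi.2 (Fin.forall_fin_two.2 ⟨?_, ?_⟩)
    · refine (h2.cexp.mul (h1 0)).congr_deriv ?_
      simp [k, genT, mulVec, dotProduct, Fin.sum_univ_two]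
      ring
    · refine (h1 1).congr_deriv ?_
      simp [k, genT, mulVec, dotProduct, Fin.sum_univ_two]
      linear_combination (-(B1 r (0, t) s 1 0) * h (0, t) 0) * e2
  have h1 := congrFun ((isFundamental_H1 hT hr s).eq_mulVec hk hkd ⟨hT.le, le_rfl⟩) 0
  have hk0 : k 0 = h (0, 0) := by
    ext i
    fin_cases i <;> simp [k]
  rw [hk0] at h1
  exact h1.symm

/-- The upper component of the integral equation at `z = 0`, `t = T`: the identity contributes `0`,
and `e^{-iλζσ̂}` multiplies the `12` entry by `e^{-2iλζ}`. -/
theorem integrableOn_cPlusIntegrand (hT : 0 < T) (hr : IsSchwartz T r) (hsol : IsSolution T r)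
    {s : ℂ} (hs : (s ^ 2).im ≤ 0) : IntegrableOn (cPlusIntegrand T r s) (Ioi 0) ∧
      H3 r T s 0 0 = -cPlus T r s := by
  have ht : T ∈ Icc 0 T := ⟨hT.le, le_rfl⟩
  have h := isH3_H3 hT hr hsol hs ht
  have e : ∀ ζ, expSigmaHatCol (Complex.I * lam s * ((0 - ζ : ℝ) : ℂ))
      (A1 r (ζ, T) s *ᵥ H3 r T s ζ) 0 = cPlusIntegrand T r s ζ := fun ζ => by
    rw [expSigmaHatCol_eq, cPlusIntegrand]
    have : 2 * (Complex.I * lam s * ((0 - ζ : ℝ) : ℂ)) = -(2 * Complex.I * lam s * ζ) := by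
      push_cast
      ring
    rw [this]
    simp [vecHead]
    ring
  constructor
  · have := (integrableOn_propagator hT hr hs ht h.continuousOn h.bounded
      (self_mem_Ici (a := (0 : ℝ)))).eval 0
    simp only [e] at this
    exact this
  · rw [h.eq 0 self_mem_Ici 0]
    simp only [e]
    simp [cPlus]

theorem global_relation (hT : 0 < T) (hr : IsSchwartz T r) (hsol : IsSolution T r)
    {s : ℂ} (hs : (s ^ 2).im ≤ 0) : u r s * V T r s - U T r s * v r s =
      Complex.exp (4 * Complex.I * lam s ^ 2 * T) * cPlus T r s := by
  have h := Winv_mulVec hT hr hsol hs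
  rw [(integrableOn_cPlusIntegrand hT hr hsol hs).2, mulVec, dotProduct, Fin.sum_univ_two] at h
  -- With determinant one, `V = -(W⁻¹)₁₂` and `U = (W⁻¹)₁₁`, so `uV - Uv` is minus the upper
  -- component of `W⁻¹(v,u)ᵀ`.
  have hW : W T r s = (Winv T r s).adjugate := by
    rw [W, inv_def, det_Winv hT hr s]
    simp
  rw [u, v, V, U, hW, adjugate_fin_two]
  simp
  linear_combination -h

end CLL

theorem mainTheorem4 (T : ℝ) (hT : 0 < T) (r : ℝ × ℝ → ℂ)
    (hr : CLL.IsSchwartz T r) (hsol : CLL.IsSolution T r) :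
    -- the eigenfunction `H₁(0, ·, ς)` exists and is unique for every `ς`, and `W` is well defined
    (∀ s : ℂ, CLL.IsH1 T r s (CLL.H1 T r s) ∧
      (∀ H, CLL.IsH1 T r s H → Set.EqOn H (CLL.H1 T r s) (Set.Icc 0 T)) ∧
      IsUnit (CLL.Winv T r s)) ∧
    -- the eigenfunction `[H₃]₂(·, t, ς)` exists and is unique for `Im ς² ≤ 0`
    (∀ s : ℂ, (s ^ 2).im ≤ 0 → ∀ t ∈ Set.Icc (0 : ℝ) T, CLL.IsH3 r t s (CLL.H3 r t s) ∧
      (∀ h, CLL.IsH3 r t s h → Set.EqOn h (CLL.H3 r t s) (Set.Ici 0))) ∧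
    -- the global relation, with an absolutely convergent integral for `c⁺`
    (∀ s : ℂ, (s ^ 2).im ≤ 0 →
      MeasureTheory.IntegrableOn (CLL.cPlusIntegrand T r s) (Set.Ioi 0) ∧
      CLL.u r s * CLL.V T r s - CLL.U T r s * CLL.v r s =
        Complex.exp (4 * Complex.I * (s ^ 2 - 1 / 2) ^ 2 * (T : ℂ)) * CLL.cPlus T r s) := by
  refine ⟨fun s => ⟨CLL.isH1_H1 hT hr s, fun H hH => hH.eqOn hT hr (CLL.isH1_H1 hT hr s), ?_⟩,
    fun s hs t ht => ⟨CLL.isH3_H3 hT hr hsol hs ht,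
      fun h hh => hh.eqOn hT hr hs ht (CLL.isH3_H3 hT hr hsol hs ht)⟩,
    fun s hs => ⟨(CLL.integrableOn_cPlusIntegrand hT hr hsol hs).1,
      CLL.global_relation hT hr hsol hs⟩⟩
  rw [Matrix.isUnit_iff_isUnit_det, CLL.det_Winv hT hr s]
  exact isUnit_one
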